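/- Let $X$ be a compact normal complex surface with exactly one singular point $p$, an $ADE$ singularity, and let $\pi:Y\to X$ be its minimal resolution, with $Y$ a smooth compact connected complex surface. Thus the irreducible components $C_1,\dots,C_n$ of $\pi^{-1}(p)$ are curves of genus zero with $C_i\cdot C_i=-2$, and their dual graph is a Dynkin diagram of type $A_n$, $D_n$ $(n\ge 4)$, $E_6$, $E_7$ or $E_8$. Write $\langle D,E\rangle=-D\cdot E$ for divisors $D,E$ on $Y$, let $\Lambda=\bigoplus_i\mathbb{Z}C_i$ and let $\Phi=\{\alpha\in\Lambda:\alpha\cdot\alpha=-2\}$, a root system with base $\{C_1,\dots,C_n\}$. Let $\mathfrak g$ be the complex simple Lie algebra with root system $\Phi$, with a Chevalley basis $\{h_i\ (1\le i\le n),\ x_\alpha\ (\alpha\in\Phi)\}$: $[h_i,h_j]=0$; $[h_i,x_\alpha]=\langle\alpha,C_i\rangle x_\alpha$; $[x_\alpha,x_{-\alpha}]=\sum_i a_ih_i$ for $\alpha=\sum_i a_iC_i$; and $[x_\alpha,x_\beta]$ is $\pm x_{\alpha+\beta}$ if $\alpha+\beta\in\Phi$, and $0$ if $0\ne\alpha+\beta\notin\Phi$.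 Let $\mathfrak h$ be the span of the $h_i$. For a divisor $D$ and $h=\sum_i c_ih_i\in\mathfrak h$ put $\langle h,D\rangle=\sum_i c_i\langle C_i,D\rangle$. A $(-1)$-curve in $Y$ is an effective divisor $l$ (possibly reducible or non-reduced) of arithmetic genus zero, i.e. $l\cdot l+K_Y\cdot l=-2$, with $l\cdot l=-1$. Let $C_0$ be a curve (effective 1-cycle) in $X$ passing through $p$ whose strict transform $\widetilde{C_0}$ is a $(-1)$-curve in $Y$ and which has minuscule multiplicity $C_k$ at $p$. This means that $\widetilde{C_0}\cdot C_k=1$ and $\widetilde{C_0}\cdot C_i=0$ for $i\ne k$, and that the irreducible finite-dimensional representation $V$ of $\mathfrak g$ whose lowest weight is dual to $-C_k$ (i.e. takes the value $-1$ at $h_k$ and $0$ at the other $h_i$) is minuscule: the Weyl group acts transitively on its weights. Let $$I=\{l:\ l \text{ is a } (-1)\text{-curve in } Y \text{ with } \pi(l)=C_0\},$$ where $\pi(l)$ is the image of $l$ as a cycle (components contracted by $\pi$ are dropped), and let $V_0=\mathbb{C}^I=\bigoplus_{l\in I}\mathbb{C}v_l$. Then: (i) One can choose signs $\varepsilon_{\alpha,l}\in\{1,-1\}$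 such that the bilinear map $\mathfrak g\times V_0\to V_0$ given by $$[h,v_l]=\langle h,l\rangle v_l\ \ (h\in\mathfrak h),\qquad [x_\alpha,v_l]=\begin{cases}\varepsilon_{\alpha,l}\,v_{l+\alpha}&\text{if } l+\alpha\in I,\\ 0&\text{if } l+\alpha\notin I,\end{cases}$$ is an action of the Lie algebra $\mathfrak g$ on $V_0$. (ii) For every choice of signs for which this is an action, $V_0$ is isomorphic, as a representation of $\mathfrak g$, to the minuscule representation $V$. (iii) $I$ is finite and $|I|=\dim V$. -/

import Mathlib

open scoped ContDiff Manifold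

noncomputable section

namespace ADESurface

/-! ### Analytic subsets and curves

Holomorphic functions on a space `M` are described by a predicate `H f y`, read
"the function `f` is holomorphic in a neighbourhood of the point `y`". -/

section Analytic

variable {M : Type*} [TopologicalSpace M]

/-- A closed analytic subset: near every point of `M` it is the common zero set of finitely many
holomorphic functions. -/
def IsAnalyticSubset (H : (M → ℂ) → M → Prop) (Z : Set M) : Prop :=
  ∀ x : M, ∃ U : Set M, IsOpen U ∧ x ∈ U ∧ ∃ (m : ℕ) (f : Fin m → M → ℂ),
    (∀ j, ∀ y ∈ U, H (f j) y) ∧ ∀ y ∈ U, (y ∈ Z ↔ ∀ j, f j y = 0)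

/-- An irreducible curve in a (connected) complex surface: an irreducible analytic subset which is
neither a point nor the whole surface. -/
structure IsIrreducibleCurve (H : (M → ℂ) → M → Prop) (Z : Set M) : Prop where
  analytic : IsAnalyticSubset H Z
  irreducible : ∀ A B : Set M, IsAnalyticSubset H A → IsAnalyticSubset H B → Z = A ∪ B →
    Z = A ∨ Z = B
  nontrivial : Z.Nontrivial
  interior_eq : interior Z = ∅

end Analytic

/-- A reduced complex space structure on a topological space `X`, given by its holomorphic
functions: locally `X` is an analytic subset of an open set `W` of `ℂⁿ`, and the holomorphic
functions are the local restrictions of holomorphic functions of `n` variables. -/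
structure ReducedComplexSpace (X : Type*) [TopologicalSpace X] where
  /-- `HolAt f x`: the function `f` is holomorphic in a neighbourhood of `x`. -/
  HolAt : (X → ℂ) → X → Prop
  exists_local_model : ∀ x : X, ∃ U : Set X, IsOpen U ∧ x ∈ U ∧
    ∃ (n m : ℕ) (φ : X → (Fin n → ℂ)) (W : Set (Fin n → ℂ)) (P : Fin m → (Fin n → ℂ) → ℂ),
      IsOpen W ∧ (∀ j, AnalyticOnNhd ℂ (P j) W) ∧
      φ '' U = {w | w ∈ W ∧ ∀ j, P j w = 0} ∧
      Topology.IsEmbedding (U.domRestrict φ) ∧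
      ∀ y ∈ U, ∀ f : X → ℂ,
        (HolAt f y ↔ ∃ F : (Fin n → ℂ) → ℂ, AnalyticAt ℂ F (φ y) ∧
          ∀ᶠ z in nhds y, f z = F (φ z))

section Surface

variable {Y : Type*} [TopologicalSpace Y] [ChartedSpace (EuclideanSpace ℂ (Fin 2)) Y]

/-- `f` is holomorphic in a neighbourhood of the point `y` of the complex surface `Y`. -/
def HolAt (f : Y → ℂ) (y : Y) : Prop :=
  ContMDiffAt 𝓘(ℂ, EuclideanSpace ℂ (Fin 2)) 𝓘(ℂ) ω f y

variable (Y) in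
/-- Irreducible (compact) curves in the surface `Y`. -/
abbrev IrredCurve : Type _ := {Z : Set Y // IsIrreducibleCurve (HolAt (Y := Y)) Z}

variable (Y) in
/-- Divisors on the smooth surface `Y`: finite integral combinations of irreducible curves. -/
abbrev Divisor : Type _ := IrredCurve Y →₀ ℤ

/-! ### Intersection numbers -/

/-- The functions on `Y` that are holomorphic near `y`. All ideals used below contain the functions
vanishing near `y`, so that quotients by them are quotients of the local ring of `Y` at `y`. -/
def holAlgebra (y : Y) : Subalgebra ℂ (Y → ℂ) where
  carrier := {f | HolAt f y}
  mul_mem' := fun ha hb => ContMDiffAt.mul ha hb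
  add_mem' := fun ha hb => ContMDiffAt.add ha hb
  algebraMap_mem' := fun _ => contMDiffAt_const

/-- The ideal of (the germ at `y` of) the subset `Z`: the functions vanishing on `Z` near `y`. -/
def vanishingIdeal (Z : Set Y) (y : Y) : Ideal (holAlgebra y) where
  carrier := {f | ∀ᶠ z in nhds y, z ∈ Z → (f : Y → ℂ) z = 0}
  add_mem' := by
    intro a b ha hb
    filter_upwards [ha, hb] with z h1 h2 hz
    simp [h1 hz, h2 hz]
  zero_mem' := by simp
  smul_mem' := by
    intro c a ha
    filter_upwards [ha] with z h1 hz
    simp [h1 hz]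

/-- The local intersection multiplicity `dim_ℂ 𝒪_{Y,y} / (I(Z) + I(Z'))` at `y`. -/
def localIntersection (Z Z' : Set Y) (y : Y) : ℕ :=
  Module.finrank ℂ (holAlgebra y ⧸ (vanishingIdeal Z y ⊔ vanishingIdeal Z' y))

/-- The order `dim_ℂ 𝒪_{Z,y} / (a)` of the function `a` along the curve `Z` at the point `y`. -/
def orderAlong (Z : Set Y) (a : Y → ℂ) (y : Y) : ℕ :=
  Module.finrank ℂ
    (holAlgebra y ⧸ (vanishingIdeal Z y ⊔ Ideal.span {g : holAlgebra y | (g : Y → ℂ) = a}))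

/-- `U` is a family of open neighbourhoods of the points of `Y`. -/
def IsNbhdFamily (U : Y → Set Y) : Prop := ∀ y, IsOpen (U y) ∧ y ∈ U y

/-- Let `L` be the line bundle on `Y` with trivializing open cover `U` and transition functions
`g`, so that the sections of `L` are the families of functions `s i` on `U i` with
`s i = g i j * s j`. Then `a i / b i` are the components of a meromorphic section of `L|_Z`, which
vanishes identically or is infinite on no branch of `Z`. -/
structure IsMeromorphicSection (Z : Set Y) (U : Y → Set Y) (g : Y → Y → Y → ℂ)
    (a b : Y → Y → ℂ) : Prop where
  hol_num : ∀ i, ∀ x ∈ U i, HolAt (a i) x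
  hol_den : ∀ i, ∀ x ∈ U i, HolAt (b i) x
  num_ne : ∀ i, ∀ x ∈ Z ∩ U i, ¬ ∀ᶠ z in nhds x, z ∈ Z → a i z = 0
  den_ne : ∀ i, ∀ x ∈ Z ∩ U i, ¬ ∀ᶠ z in nhds x, z ∈ Z → b i z = 0
  glue : ∀ i j, ∀ x ∈ Z ∩ U i ∩ U j, a i x * b j x = g i j x * (a j x * b i x)

/-- `n` is the degree on the curve `Z` of the line bundle with transition functions `g` on the
cover `U`: the number of zeros minus the number of poles of a meromorphic section over `Z`. -/
def IsDegree (Z : Set Y) (U : Y → Set Y) (g : Y → Y → Y → ℂ) (n : ℤ) : Prop :=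
  ∃ a b : Y → Y → ℂ, IsMeromorphicSection Z U g a b ∧
    n = ∑ᶠ y ∈ Z, ((orderAlong Z (a y) y : ℤ) - (orderAlong Z (b y) y : ℤ))

/-- `f` is a local equation of `Z` at `y`: a generator of the ideal of `Z` in the local ring. -/
def IsLocalEquation (Z : Set Y) (f : Y → ℂ) (y : Y) : Prop :=
  HolAt f y ∧ (∀ᶠ z in nhds y, z ∈ Z → f z = 0) ∧
    ∀ h : Y → ℂ, HolAt h y → (∀ᶠ z in nhds y, z ∈ Z → h z = 0) →
      ∃ q : Y → ℂ, HolAt q y ∧ ∀ᶠ z in nhds y, h z = q z * f z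

/-- `n` is the degree of the line bundle `𝒪_Y(Z)` on `Z`, i.e. of the normal bundle of `Z`. The
transition functions of `𝒪_Y(Z)` are the quotients of local equations of `Z`. -/
def IsNormalDegree (Z : Set Y) (n : ℤ) : Prop :=
  ∃ (U : Y → Set Y) (f : Y → Y → ℂ) (g : Y → Y → Y → ℂ), IsNbhdFamily U ∧
    (∀ i, ∀ x ∈ U i, IsLocalEquation Z (f i) x) ∧
    (∀ i j, ∀ x ∈ U i ∩ U j, HolAt (g i j) x ∧ f i x = g i j x * f j x) ∧
    IsDegree Z U g n

/-- The transition functions of the canonical bundle `K_Y`, trivialized by `dz₁ ∧ dz₂` in the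
charts of `Y`: the Jacobian determinants of the coordinate changes. -/
def canonicalTransition (i j x : Y) : ℂ :=
  (fderiv ℂ (chartAt (EuclideanSpace ℂ (Fin 2)) j ∘ (chartAt (EuclideanSpace ℂ (Fin 2)) i).symm)
    (chartAt (EuclideanSpace ℂ (Fin 2)) i x)).det

/-- `n` is the degree of the canonical bundle `K_Y` on `Z`. -/
def IsCanonicalDegree (Z : Set Y) (n : ℤ) : Prop :=
  ∃ U : Y → Set Y, IsNbhdFamily U ∧
    (∀ i, U i ⊆ (chartAt (EuclideanSpace ℂ (Fin 2)) i).source) ∧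
    IsDegree Z U canonicalTransition n

open scoped Classical in
/-- The self-intersection number of an irreducible curve: the degree of its normal bundle. -/
def selfIntersection (Z : Set Y) : ℤ :=
  if h : ∃ n, IsNormalDegree Z n then h.choose else 0

open scoped Classical in
/-- The intersection number of two irreducible curves. -/
def curveIntersection (Z Z' : IrredCurve Y) : ℤ :=
  if Z = Z' then selfIntersection Z.1 else ∑ᶠ y, (localIntersection Z.1 Z'.1 y : ℤ)

open scoped Classical in
/-- The intersection number `K_Y · Z` of the canonical class with an irreducible curve. -/
def curveCanonicalDegree (Z : IrredCurve Y) : ℤ :=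
  if h : ∃ n, IsCanonicalDegree Z.1 n then h.choose else 0

/-- The intersection number `D · E` of two divisors. -/
def intersection (D E : Divisor Y) : ℤ :=
  D.sum fun Z m => E.sum fun Z' n => m * n * curveIntersection Z Z'

/-- The intersection number `K_Y · D`. -/
def canonicalDegree (D : Divisor Y) : ℤ :=
  D.sum fun Z m => m * curveCanonicalDegree Z

/-- The inner product on divisors: the negative of the intersection product. -/
def pairing (D E : Divisor Y) : ℤ := -intersection D E

/-- The divisor of an irreducible curve. -/
def curveDivisor (Z : IrredCurve Y) : Divisor Y := Finsupp.single Z 1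

/-- The (arithmetic) genus of a possibly reducible or non-reduced curve `D`, given by the genus
formula `2 g - 2 = D · D + K_Y · D`. -/
def genus (D : Divisor Y) : ℚ := 1 + ((intersection D D + canonicalDegree D : ℤ) : ℚ) / 2

/-- A `(-1)`-curve: an effective divisor of genus zero with self-intersection `-1`. -/
structure IsNegOneCurve (l : Divisor Y) : Prop where
  effective : 0 ≤ l
  genus_eq : genus l = 0
  self_intersection : intersection l l = -1

/-! ### Surfaces with an `ADE` singularity -/

variable {X : Type*} [TopologicalSpace X]

/-- `π : Y → X` is a resolution of the normal complex surface `X`, whose only singular point is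
`p`. The condition `holAt_iff` is `𝒪_X = π_* 𝒪_Y`: away from `p` it says that `π` is biholomorphic,
and at `p` that `π` is holomorphic and `X` is normal. -/
structure IsNormalResolution (𝒳 : ReducedComplexSpace X) (π : Y → X) (p : X) : Prop where
  continuous : Continuous π
  surjective : Function.Surjective π
  inj_away : ∀ y y', π y = π y' → π y ≠ p → y = y'
  holAt_iff : ∀ (f : X → ℂ) (x : X), 𝒳.HolAt f x ↔ ∀ y, π y = x → HolAt (f ∘ π) y

/-- The Cartan matrices of type `A_n`, `D_n`, `E_6`, `E_7`, `E_8`, with rows and columns indexed by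
`ι`. -/
def IsADECartanMatrix {ι : Type*} (A : Matrix ι ι ℤ) : Prop :=
  (∃ n, 1 ≤ n ∧ ∃ e : ι ≃ Fin n, A = (CartanMatrix.A n).submatrix e e) ∨
  (∃ n, 4 ≤ n ∧ ∃ e : ι ≃ Fin n, A = (CartanMatrix.D n).submatrix e e) ∨
  (∃ e : ι ≃ Fin 6, A = CartanMatrix.E₆.submatrix e e) ∨
  (∃ e : ι ≃ Fin 7, A = CartanMatrix.E₇.submatrix e e) ∨
  (∃ e : ι ≃ Fin 8, A = CartanMatrix.E₈.submatrix e e)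

/-- The exceptional divisor over `p` has the irreducible components `C i`, these are
`(-2)`-curves (of genus zero and self-intersection `-2`), and their dual graph is an `ADE` Dynkin
diagram. So `p` is an `ADE` singularity and `π` its minimal resolution. -/
structure IsADEResolution {ι : Type*} (π : Y → X) (p : X) (C : ι → IrredCurve Y) : Prop where
  injective : Function.Injective C
  component : ∀ Z : IrredCurve Y, Z ∈ Set.range C ↔ Z.1 ⊆ π ⁻¹' {p}
  fiber : π ⁻¹' {p} = ⋃ i, (C i).1
  genus_eq : ∀ i, genus (curveDivisor (C i)) = 0
  cartan : IsADECartanMatrix (Matrix.of fun i j => pairing (curveDivisor (C i)) (curveDivisor (C j)))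

/-- A curve in `X`, as a cycle: a combination of irreducible curves with positive coefficients. -/
structure IsCurveIn (𝒳 : ReducedComplexSpace X) (C₀ : Set X →₀ ℤ) : Prop where
  effective : 0 ≤ C₀
  curve : ∀ Z ∈ C₀.support, IsIrreducibleCurve 𝒳.HolAt Z

open scoped Classical in
/-- The image `π(D)` of a curve, as a cycle in `X`: the components contracted by `π` are dropped,
and the others are replaced by their images. -/
def image (π : Y → X) (D : Divisor Y) : Set X →₀ ℤ :=
  (D.filter fun Z => ¬ (π '' Z.1).Subsingleton).mapDomain fun Z => π '' Z.1

/-- `D` is the strict transform of `C₀`: no component of `D` is contracted, and `π(D) = C₀`. -/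
structure IsStrictTransform (π : Y → X) (C₀ : Set X →₀ ℤ) (D : Divisor Y) : Prop where
  not_contracted : ∀ Z ∈ D.support, ¬ (π '' Z.1).Subsingleton
  image_eq : image π D = C₀

/-- The multiplicity `∑ (D · C i) C i` at the singular point of the curve with strict
transform `D`. -/
def multiplicity {ι : Type*} [Fintype ι] (C : ι → IrredCurve Y) (D : Divisor Y) : Divisor Y :=
  ∑ i, intersection D (curveDivisor (C i)) • curveDivisor (C i)

/-- The set `I` of `(-1)`-curves `l` in `Y` with `π(l) = C₀`. -/
def negOneCurvesOver (π : Y → X) (C₀ : Set X →₀ ℤ) : Set (Divisor Y) :=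
  {l | IsNegOneCurve l ∧ image π l = C₀}

/-! ### The Lie algebra of the root system and its representations -/

/-- The root system `Φ = {α ∈ Λ | α · α = -2}`, where `Λ` is the lattice spanned by the `C i`. -/
def rootSet {ι : Type*} (C : ι → IrredCurve Y) : Set (Divisor Y) :=
  {α | α ∈ AddSubgroup.closure (Set.range fun i => curveDivisor (C i)) ∧ intersection α α = -2}

/-- A Chevalley basis `{h i, x α}` of the Lie algebra `𝔤` with respect to the simply-laced root
system `Φ` with base `C`. The coefficient of `C i` in the root `α` is `α (C i)`, so that `lie_x_neg`
says that `[x α, x (-α)]` is the coroot of `α`. -/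
structure ChevalleyBasis {ι : Type*} [Fintype ι] (C : ι → IrredCurve Y)
    (𝔤 : Type*) [LieRing 𝔤] [LieAlgebra ℂ 𝔤] where
  /-- The basis of the Cartan subalgebra. -/
  h : ι → 𝔤
  /-- The root vectors. -/
  x : rootSet C → 𝔤
  linearIndependent : LinearIndependent ℂ (Sum.elim h x)
  span_eq_top : Submodule.span ℂ (Set.range (Sum.elim h x)) = ⊤
  lie_h_h : ∀ i j, ⁅h i, h j⁆ = 0
  lie_h_x : ∀ i α, ⁅h i, x α⁆ = (pairing α.1 (curveDivisor (C i)) : ℂ) • x α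
  lie_x_neg : ∀ α β : rootSet C, β.1 = -α.1 → ⁅x α, x β⁆ = ∑ i, (α.1 (C i) : ℂ) • h i
  lie_x_add : ∀ α β γ : rootSet C, γ.1 = α.1 + β.1 → ⁅x α, x β⁆ = x γ ∨ ⁅x α, x β⁆ = -x γ
  lie_x_zero : ∀ α β : rootSet C, α.1 + β.1 ≠ 0 → α.1 + β.1 ∉ rootSet C → ⁅x α, x β⁆ = 0

section Representation

variable {ι : Type*} [Fintype ι] {C : ι → IrredCurve Y}
  {𝔤 : Type*} [LieRing 𝔤] [LieAlgebra ℂ 𝔤] (B : ChevalleyBasis C 𝔤)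
  (V : Type*) [AddCommGroup V] [Module ℂ V] [LieRingModule 𝔤 V] [LieModule ℂ 𝔤 V]

/-- `μ` is a weight of `V`. A linear form on the Cartan subalgebra is given by its values
`μ i` at the `h i`. -/
def IsWeight (μ : ι → ℂ) : Prop := ∃ v : V, v ≠ 0 ∧ ∀ i, ⁅B.h i, v⁆ = μ i • v

variable (C) in
/-- The Weyl group acting on weights, generated by the reflections `μ ↦ μ - μ(α^∨) α`. -/
def weylGroup : Subgroup ((ι → ℂ) ≃ₗ[ℂ] (ι → ℂ)) :=
  Subgroup.closure {w | ∃ α ∈ rootSet C, ∀ (μ : ι → ℂ) (i : ι),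
    w μ i = μ i - (∑ j, (α (C j) : ℂ) * μ j) * (pairing α (curveDivisor (C i)) : ℂ)}

/-- `V` is a minuscule representation: it is finite-dimensional and irreducible, and the Weyl group
acts transitively on its weights. -/
structure IsMinuscule : Prop where
  finiteDimensional : FiniteDimensional ℂ V
  irreducible : LieModule.IsIrreducible ℂ 𝔤 V
  transitive : ∀ μ ν : ι → ℂ, IsWeight B V μ → IsWeight B V ν → ∃ w ∈ weylGroup C, w μ = ν

/-- `V` has a lowest weight vector whose weight is dual to `-C k`, i.e. takes the value `-1` at
`h k` and `0` at the other `h i`. -/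
def HasLowestWeightDualToNeg (k : ι) : Prop :=
  ∃ v : V, v ≠ 0 ∧ ⁅B.h k, v⁆ = -v ∧ (∀ i, i ≠ k → ⁅B.h i, v⁆ = 0) ∧
    ∀ α : rootSet C, α.1 ≤ 0 → ⁅B.x α, v⁆ = 0

/-- The bilinear map `ρ`, `(x, v) ↦ ρ x v`, is an action of `𝔤` on `ℂ^I`, and it is given on the basis vectors
`v_l = Finsupp.single l 1` by the formulas `[h, v_l] = ⟨h, l⟩ v_l` for `h` in the Cartan subalgebra,
`[x α, v_l] = ε α l * v_{l + α}` if `l + α ∈ I`, and `[x α, v_l] = 0` if `l + α ∉ I`. -/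
structure IsCurveAction (I : Set (Divisor Y)) (ε : rootSet C → I → ℤˣ)
    (ρ : 𝔤 →ₗ[ℂ] (I →₀ ℂ) →ₗ[ℂ] (I →₀ ℂ)) : Prop where
  lie : ∀ (x y : 𝔤) (v : I →₀ ℂ), ρ ⁅x, y⁆ v = ρ x (ρ y v) - ρ y (ρ x v)
  cartan : ∀ (c : ι → ℂ) (l : I), ρ (∑ i, c i • B.h i) (Finsupp.single l 1) =
    (∑ i, c i * (pairing (curveDivisor (C i)) l.1 : ℂ)) • Finsupp.single l 1
  root : ∀ (α : rootSet C) (l : I) (hl : l.1 + α.1 ∈ I),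
    ρ (B.x α) (Finsupp.single l 1) = ((ε α l : ℤ) : ℂ) • Finsupp.single ⟨l.1 + α.1, hl⟩ 1
  root_zero : ∀ (α : rootSet C) (l : I), l.1 + α.1 ∉ I → ρ (B.x α) (Finsupp.single l 1) = 0

end Representation

end Surface

end ADESurface

end

/-! Everything reduces to the lattice Λ spanned by the `C i`. Since `π` is injective off `p` and
contracts exactly the `C i`, a divisor with image `C₀` is `C₀t + β` with β in Λ. As `C₀t` pairs with
the `C i` like the weight -ω_k, this divisor takes on the `h i` the values of β - ω_k, and its
self-intersection is -1 - (|β - ω_k|² - |ω_k|²). Adjunction gives K·C_i = 0, so the genus condition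
follows. Hence I corresponds to the β with |β - ω_k| = |ω_k|, that is with `excess` zero, once these
are known to be effective.

On the other side, transitivity of the Weyl group puts every weight of V of the form β - ω_k on this
same sphere. So a root vector can act nontrivially on a weight vector only if the weight takes the
value -1 at the root, and the relation for [X_α, X_{-α}] then confines all such values to -1, 0, 1.
At the lowest weight this says that positive roots have coefficient at most 1 at k. From that bound
alone, lattice arguments show that every β on the sphere is nonnegative and descends to 0 by
subtracting simple roots without leaving the sphere (`nonneg_of_excess_eq_zero`,
`exists_level_eq_one`).

Climbing back from the lowest weight vector with the simple root vectors produces one vector for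
each β, independently of the path (`exists_weightFamily`), and every root vector kills these vectors
or permutes them up to sign (`root_sign`). They are independent, and by irreducibility they span V.
This basis indexed by I gives (iii) and, by transport, (i). For (ii), any curve action has the same
weights, hence a family of the same kind, and matching the two families is equivariant because the
`h i` and the simple root vectors with their opposites generate 𝔤. -/

namespace ADESurface

/-! ### Positive definiteness of the Cartan matrices -/

section Cartan

open Matrix

/-- A symmetric integral matrix with nonpositive off-diagonal entries which maps some positive
vector to a positive vector is positive definite. -/
theorem sum_mul_mul_pos_of_pos_vector {ι : Type*} [Fintype ι] (A : Matrix ι ι ℤ)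
    (hs : A.IsSymm) (ho : ∀ i j, i ≠ j → A i j ≤ 0) (u : ι → ℤ) (hu : ∀ i, 0 < u i)
    (hAu : ∀ i, 0 < ∑ j, A i j * u j) (x : ι → ℤ) (hx : x ≠ 0) :
    0 < ∑ i, ∑ j, x i * x j * A i j := by
  have hu' : ∀ i, (0 : ℚ) < u i := fun i => by exact_mod_cast hu i
  -- The AM-GM bound on `x i * x j`, reversed by `A i j ≤ 0` off the diagonal. Summed, the lower
  -- bound becomes ∑ x_i²/u_i · (A u)_i.
  have key : ∀ i j, (A i j : ℚ) * (((x i : ℚ) ^ 2 / u i * u j + (x j : ℚ) ^ 2 / u j * u i) / 2) ≤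
      (x i * x j * A i j : ℚ) := by
    intro i j
    have hi := hu' i
    have hj := hu' j
    by_cases h : i = j
    · subst h
      apply le_of_eq
      field_simp
      ring
    · have hA : (A i j : ℚ) ≤ 0 := by exact_mod_cast ho i j h
      have h1 : (x i * x j : ℚ) ≤ ((x i : ℚ) ^ 2 / u i * u j + (x j : ℚ) ^ 2 / u j * u i) / 2 := by
        have h2 : ((x i : ℚ) ^ 2 / u i * u j + (x j : ℚ) ^ 2 / u j * u i) / 2 - x i * x j =
            (x i * u j - x j * u i) ^ 2 / (2 * u i * u j) := by
          field_simp
          ring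
        have h3 : 0 ≤ ((x i : ℚ) * u j - x j * u i) ^ 2 / (2 * u i * u j) := by positivity
        linarith
      nlinarith
  have hsum : ∑ i, ∑ j, (A i j : ℚ) * (((x i : ℚ) ^ 2 / u i * u j + (x j : ℚ) ^ 2 / u j * u i) / 2)
      = ∑ i, (x i : ℚ) ^ 2 / u i * ∑ j, A i j * u j := by
    have h1 : ∑ i, ∑ j, (A i j : ℚ) * ((x j : ℚ) ^ 2 / u j * u i) =
        ∑ i, ∑ j, (A i j : ℚ) * ((x i : ℚ) ^ 2 / u i * u j) := by
      rw [Finset.sum_comm]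
      exact Finset.sum_congr rfl fun i _ => Finset.sum_congr rfl fun j _ => by rw [hs.apply]
    have h2 : ∑ i, ∑ j,
        (A i j : ℚ) * (((x i : ℚ) ^ 2 / u i * u j + (x j : ℚ) ^ 2 / u j * u i) / 2) =
        (∑ i, ∑ j, (A i j : ℚ) * ((x i : ℚ) ^ 2 / u i * u j) +
        ∑ i, ∑ j, (A i j : ℚ) * ((x j : ℚ) ^ 2 / u j * u i)) / 2 := by
      rw [← Finset.sum_add_distrib, Finset.sum_div]
      refine Finset.sum_congr rfl fun i _ => ?_
      rw [← Finset.sum_add_distrib, Finset.sum_div]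
      exact Finset.sum_congr rfl fun j _ => by ring
    rw [h2, h1, add_self_div_two]
    refine Finset.sum_congr rfl fun i _ => ?_
    rw [Int.cast_sum, Finset.mul_sum]
    exact Finset.sum_congr rfl fun j _ => by push_cast; ring
  have hpos : (0 : ℚ) < ∑ i, (x i : ℚ) ^ 2 / u i * ∑ j, A i j * u j := by
    obtain ⟨i, hi⟩ := Function.ne_iff.mp hx
    have hA : ∀ i, (0 : ℚ) < ∑ j, A i j * u j := fun i => by exact_mod_cast hAu i
    refine Finset.sum_pos' (fun i _ => ?_) ⟨i, Finset.mem_univ i, ?_⟩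
    · have := hu' i
      have := hA i
      positivity
    · have := hu' i
      have := hA i
      have : (x i : ℚ) ≠ 0 := by exact_mod_cast hi
      positivity
  have : (0 : ℚ) < ∑ i, ∑ j, (x i * x j * A i j : ℚ) := by
    rw [← hsum] at hpos
    exact hpos.trans_le (Finset.sum_le_sum fun i _ => Finset.sum_le_sum fun j _ => key i j)
  exact_mod_cast this

/-- The vector consists of the coefficients of the sum of the positive roots, which pairs to 2 with
every simple root. -/
theorem cartanMatrix_A_pos_vector (n : ℕ) : ∃ u : Fin n → ℤ, (∀ i, 0 < u i) ∧
    ∀ i, 0 < ∑ j, CartanMatrix.A n i j * u j := by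
  refine ⟨fun i => (i.1 + 1) * (n - i.1), fun i => ?_, fun i => ?_⟩
  · have := i.2
    have : (0 : ℤ) < n - i.1 := by omega
    positivity
  · have hsum : ∑ j, CartanMatrix.A n i j * (((j.1 : ℤ) + 1) * (n - j.1)) =
        ∑ j ∈ Finset.range n, ((if i.1 = j then 2 * (((j : ℤ) + 1) * (n - j)) else 0) -
          (if i.1 + 1 = j then (((j : ℤ) + 1) * (n - j)) else 0) -
          (if j + 1 = i.1 then (((j : ℤ) + 1) * (n - j)) else 0)) := by
      rw [Finset.sum_range]
      refine Finset.sum_congr rfl fun j _ => ?_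
      simp only [CartanMatrix.A, of_apply, Fin.ext_iff]
      split_ifs <;> omega
    rw [hsum, Finset.sum_sub_distrib, Finset.sum_sub_distrib, Finset.sum_ite_eq,
      Finset.sum_ite_eq]
    obtain ⟨i, hi⟩ := i
    -- The last node has no right neighbour, but the closed formula vanishes there; likewise on the
    -- left for the first node.
    have hlast : (if i + 1 ∈ Finset.range n then (((i + 1 : ℕ) : ℤ) + 1) * (n - (i + 1 : ℕ)) else 0)
        = ((i : ℤ) + 2) * (n - i - 1) := by
      split_ifs with h
      · push_cast; ring
      · have : (n : ℤ) = i + 1 := by simp at h; omega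
        rw [this]; ring
    have hfirst : (∑ j ∈ Finset.range n, if j + 1 = i then ((j : ℤ) + 1) * (n - j) else 0)
        = (i : ℤ) * (n - i + 1) := by
      cases i with
      | zero => simp
      | succ i =>
        simp only [Nat.add_right_cancel_iff]
        rw [Finset.sum_ite_eq', if_pos (Finset.mem_range.2 (by omega))]
        push_cast; ring
    rw [hlast, hfirst, if_pos (Finset.mem_range.2 hi)]
    ring_nf
    norm_num

theorem cartanMatrix_D_pos_vector (n : ℕ) (hn : 4 ≤ n) : ∃ u : Fin n → ℤ, (∀ i, 0 < u i) ∧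
    ∀ i, 0 < ∑ j, CartanMatrix.D n i j * u j := by
  -- Twice the sum of the positive roots, which avoids the halves n(n-1)/2 at the two fork ends;
  -- every row then gives 4.
  let v : ℕ → ℤ := fun i => if i + 2 < n then 2 * (i + 1) * (2 * n - i - 2) else n * (n - 1)
  refine ⟨fun i => v i, fun i => ?_, fun i => ?_⟩
  · have := i.2
    simp only [v]
    split_ifs
    · have : (0 : ℤ) < 2 * n - i.1 - 2 := by omega
      positivity
    · have : (0 : ℤ) < n - 1 := by omega
      positivity
  · suffices h : ∑ j, CartanMatrix.D n i j * v j = 4 by rw [h]; norm_num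
    obtain ⟨i, hi⟩ := i
    obtain ⟨m, rfl⟩ : ∃ m, n = m + 4 := ⟨n - 4, by omega⟩
    have hR : ∀ a : ℕ, a < m + 4 → ∑ j ∈ Finset.range (m + 4), (if a = j then v j else 0) = v a :=
      fun a ha => by rw [Finset.sum_ite_eq, if_pos (Finset.mem_range.2 ha)]
    have hcases : i = 0 ∨ (0 < i ∧ i < m + 1) ∨ i = m + 1 ∨ i = m + 2 ∨ i = m + 3 := by omega
    rcases hcases with rfl | ⟨h0, h1⟩ | rfl | rfl | rfl
    · have : ∑ j, CartanMatrix.D (m + 4) ⟨0, hi⟩ j * v j =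
          ∑ j ∈ Finset.range (m + 4), (2 * (if 0 = j then v j else 0) -
            (if 1 = j then v j else 0)) := by
        rw [Finset.sum_range]
        refine Finset.sum_congr rfl fun j _ => ?_
        simp only [CartanMatrix.D, of_apply, Fin.ext_iff]
        split_ifs <;> first | ring1 | grind
      rw [this, Finset.sum_sub_distrib, ← Finset.mul_sum, hR _ (by omega), hR _ (by omega)]
      simp only [v]
      rw [if_pos (by omega), if_pos (by omega)]
      push_cast; ring
    · obtain ⟨i, rfl⟩ : ∃ k, i = k + 1 := ⟨i - 1, by omega⟩
      have : ∑ j, CartanMatrix.D (m + 4) ⟨i + 1, hi⟩ j * v j =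
          ∑ j ∈ Finset.range (m + 4), (2 * (if i + 1 = j then v j else 0) -
            (if i = j then v j else 0) - (if i + 2 = j then v j else 0)) := by
        rw [Finset.sum_range]
        refine Finset.sum_congr rfl fun j _ => ?_
        simp only [CartanMatrix.D, of_apply, Fin.ext_iff]
        split_ifs <;> first | ring1 | grind
      rw [this, Finset.sum_sub_distrib, Finset.sum_sub_distrib, ← Finset.mul_sum, hR _ (by omega),
        hR _ (by omega), hR _ (by omega)]
      simp only [v]
      rw [if_pos (by omega), if_pos (by omega), if_pos (by omega)]
      push_cast; ring
    · have : ∑ j, CartanMatrix.D (m + 4) ⟨m + 1, hi⟩ j * v j =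
          ∑ j ∈ Finset.range (m + 4), (2 * (if m + 1 = j then v j else 0) -
            (if m = j then v j else 0) - (if m + 2 = j then v j else 0) -
            (if m + 3 = j then v j else 0)) := by
        rw [Finset.sum_range]
        refine Finset.sum_congr rfl fun j _ => ?_
        simp only [CartanMatrix.D, of_apply, Fin.ext_iff]
        split_ifs <;> first | ring1 | grind
      rw [this, Finset.sum_sub_distrib, Finset.sum_sub_distrib, Finset.sum_sub_distrib,
        ← Finset.mul_sum, hR _ (by omega), hR _ (by omega), hR _ (by omega), hR _ (by omega)]
      simp only [v]
      rw [if_pos (by omega), if_pos (by omega), if_neg (by omega), if_neg (by omega)]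
      push_cast; ring
    · have : ∑ j, CartanMatrix.D (m + 4) ⟨m + 2, hi⟩ j * v j =
          ∑ j ∈ Finset.range (m + 4), (2 * (if m + 2 = j then v j else 0) -
            (if m + 1 = j then v j else 0)) := by
        rw [Finset.sum_range]
        refine Finset.sum_congr rfl fun j _ => ?_
        simp only [CartanMatrix.D, of_apply, Fin.ext_iff]
        split_ifs <;> first | ring1 | grind
      rw [this, Finset.sum_sub_distrib, ← Finset.mul_sum, hR _ (by omega), hR _ (by omega)]
      simp only [v]
      rw [if_neg (by omega), if_pos (by omega)]
      push_cast; ring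
    · have : ∑ j, CartanMatrix.D (m + 4) ⟨m + 3, hi⟩ j * v j =
          ∑ j ∈ Finset.range (m + 4), (2 * (if m + 3 = j then v j else 0) -
            (if m + 1 = j then v j else 0)) := by
        rw [Finset.sum_range]
        refine Finset.sum_congr rfl fun j _ => ?_
        simp only [CartanMatrix.D, of_apply, Fin.ext_iff]
        split_ifs <;> first | ring1 | grind
      rw [this, Finset.sum_sub_distrib, ← Finset.mul_sum, hR _ (by omega), hR _ (by omega)]
      simp only [v]
      rw [if_neg (by omega), if_pos (by omega)]
      push_cast; ring

theorem IsADECartanMatrix.exists_equiv {ι : Type*} {A : Matrix ι ι ℤ} (h : IsADECartanMatrix A) :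
    ∃ (n : ℕ) (e : ι ≃ Fin n) (A' : Matrix (Fin n) (Fin n) ℤ), A = A'.submatrix e e ∧
      A'.IsSymm ∧ (∀ i, A' i i = 2) ∧ (∀ i j, i ≠ j → A' i j ≤ 0) ∧
      ∃ u : Fin n → ℤ, (∀ i, 0 < u i) ∧ ∀ i, 0 < ∑ j, A' i j * u j := by
  obtain ⟨n, -, e, h⟩ | ⟨n, hn, e, h⟩ | ⟨e, h⟩ | ⟨e, h⟩ | ⟨e, h⟩ := h
  · exact ⟨n, e, _, h, CartanMatrix.A_isSymm n, fun i => by simp [CartanMatrix.A],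
      CartanMatrix.A_apply_le_zero_of_ne n, cartanMatrix_A_pos_vector n⟩
  · exact ⟨n, e, _, h, CartanMatrix.D_isSymm n, CartanMatrix.D_diag n,
      CartanMatrix.D_off_diag_nonpos n, cartanMatrix_D_pos_vector n hn⟩
  -- For the exceptional types too, the vectors are the coefficients of the sum of the positive
  -- roots.
  · exact ⟨6, e, _, h, CartanMatrix.E₆_isSymm, CartanMatrix.E₆_diag,
      CartanMatrix.E₆_off_diag_nonpos, ![16, 22, 30, 42, 30, 16], by decide, by decide⟩
  · exact ⟨7, e, _, h, CartanMatrix.E₇_isSymm, CartanMatrix.E₇_diag,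
      CartanMatrix.E₇_off_diag_nonpos, ![34, 49, 66, 96, 75, 52, 27], by decide, by decide⟩
  · exact ⟨8, e, _, h, CartanMatrix.E₈_isSymm, CartanMatrix.E₈_diag,
      CartanMatrix.E₈_off_diag_nonpos, ![92, 136, 182, 270, 220, 168, 114, 58], by decide,
      by decide⟩

theorem IsADECartanMatrix.posDef {ι : Type*} [Fintype ι] {A : Matrix ι ι ℤ}
    (h : IsADECartanMatrix A) : A.IsSymm ∧ (∀ i, A i i = 2) ∧ (∀ i j, i ≠ j → A i j ≤ 0) ∧
      ∀ x : ι → ℤ, x ≠ 0 → 0 < ∑ i, ∑ j, x i * x j * A i j := by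
  obtain ⟨n, e, A, rfl, hs, hd, ho, u, hu, hAu⟩ := h.exists_equiv
  refine ⟨hs.submatrix _, fun i => hd _, fun i j hij => ho _ _ (e.injective.ne hij), fun x hx => ?_⟩
  refine sum_mul_mul_pos_of_pos_vector (A.submatrix e e) (hs.submatrix _)
    (fun i j hij => ho _ _ (e.injective.ne hij)) (u ∘ e) (fun i => hu _) (fun i => ?_) x hx
  have : ∑ j, A.submatrix e e i j * (u ∘ e) j = ∑ j, A (e i) j * u j := by
    rw [← e.sum_comp]; rfl
  rw [this]
  exact hAu _

end Cartan

end ADESurface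

namespace ADESurface

/-! ### Simply-laced forms and the weights of a minuscule representation -/

section Form

variable {ι : Type*}

/-- The value at the coroot of `α` of the weight `β - ω_k`. -/
def level (f : LinearMap.BilinForm ℤ (ι → ℤ)) (k : ι) (β α : ι → ℤ) : ℤ := f β α - α k

/-- The difference of the squared norms of the weights `β - ω_k` and `ω_k`. -/
def excess (f : LinearMap.BilinForm ℤ (ι → ℤ)) (k : ι) (β : ι → ℤ) : ℤ := f β β - 2 * β k

variable {f : LinearMap.BilinForm ℤ (ι → ℤ)} {k : ι}

theorem level_zero_left (α : ι → ℤ) : level f k 0 α = -α k := by simp [level]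

theorem level_add_right (β α γ : ι → ℤ) :
    level f k β (α + γ) = level f k β α + level f k β γ := by
  simp [level]; ring

theorem level_neg_right (β α : ι → ℤ) : level f k β (-α) = -level f k β α := by
  simp [level]; ring

theorem level_add_left (β α γ : ι → ℤ) : level f k (β + γ) α = level f k β α + f γ α := by
  simp [level]; ring

theorem level_sub_left (β α γ : ι → ℤ) : level f k (β - γ) α = level f k β α - f γ α := by
  simp [level]; ring

theorem excess_zero : excess f k 0 = 0 := by simp [excess]

theorem ne_zero_of_root {α : ι → ℤ} (hα : f α α = 2) : α ≠ 0 := by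
  rintro rfl; simp at hα

variable [DecidableEq ι]

/-- The `i`-th standard basis vector of `ℤ^ι`. -/
abbrev unitVec (i : ι) : ι → ℤ := Pi.single i 1

/-- A positive definite symmetric form on `ℤ^ι` for which the standard basis vectors are the simple
roots of a simply-laced root system. -/
structure IsSimplyLacedForm (f : LinearMap.BilinForm ℤ (ι → ℤ)) : Prop where
  symm : ∀ a b, f a b = f b a
  diag : ∀ i, f (unitVec i) (unitVec i) = 2
  off : ∀ i j, i ≠ j → f (unitVec i) (unitVec j) ≤ 0
  pos : ∀ b, b ≠ 0 → 0 < f b b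

/-- The sum of the coefficients of `β`. -/
abbrev height [Fintype ι] (β : ι → ℤ) : ℤ := ∑ i, β i

namespace IsSimplyLacedForm

theorem excess_add (hf : IsSimplyLacedForm f) (β α : ι → ℤ) :
    excess f k (β + α) = excess f k β + 2 * level f k β α + f α α := by
  simp only [excess, level, map_add, LinearMap.add_apply, Pi.add_apply, hf.symm α β]; ring

theorem excess_add_root (hf : IsSimplyLacedForm f) {α : ι → ℤ} (hα : f α α = 2) (β : ι → ℤ) :
    excess f k (β + α) = excess f k β + 2 * level f k β α + 2 := by rw [hf.excess_add, hα]

theorem excess_sub_root (hf : IsSimplyLacedForm f) {α : ι → ℤ} (hα : f α α = 2) (β : ι → ℤ) :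
    excess f k (β - α) = excess f k β - 2 * level f k β α + 2 := by
  rw [sub_eq_add_neg, hf.excess_add_root (by simpa using hα), level_neg_right]; ring

/-- Reflecting β - ω_k in the root α subtracts `level f k β α • α` from β, and reflections are
isometries. -/
theorem excess_reflection (hf : IsSimplyLacedForm f) {α : ι → ℤ} (hα : f α α = 2) (β : ι → ℤ) :
    excess f k (β - level f k β α • α) = excess f k β := by
  rw [sub_eq_add_neg, ← neg_smul, hf.excess_add]
  simp only [level, map_smul, LinearMap.smul_apply, hα, Pi.smul_apply, smul_eq_mul]; ring

theorem eq_zero_of_nonpos (hf : IsSimplyLacedForm f) {b : ι → ℤ} (h : f b b ≤ 0) : b = 0 := by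
  by_contra hb
  exact absurd (hf.pos b hb) (not_lt.2 h)

/-- The sum of two simple roots has norm 4 + 2f, which must be positive. -/
theorem apply_unitVec_eq (hf : IsSimplyLacedForm f) {i j : ι} (hij : i ≠ j) :
    f (unitVec i) (unitVec j) = 0 ∨ f (unitVec i) (unitVec j) = -1 := by
  have h1 := hf.off i j hij
  have h2 : f (unitVec i + unitVec j) (unitVec i + unitVec j) =
      4 + 2 * f (unitVec i) (unitVec j) := by
    simp only [map_add, LinearMap.add_apply, hf.symm (unitVec j) (unitVec i), hf.diag]; ring
  have h3 := hf.pos (unitVec i + unitVec j) fun h => by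
    have := congrFun h i
    simp [hij] at this
  omega

variable [Fintype ι]

theorem eq_sum_unitVec (b : ι → ℤ) : b = ∑ i, b i • unitVec i := by
  ext j
  simp [Finset.sum_apply, Pi.single_apply]

theorem apply_eq_sum (b c : ι → ℤ) : f b c = ∑ i, b i * f (unitVec i) c := by
  conv_lhs => rw [eq_sum_unitVec b]
  simp only [map_sum, LinearMap.sum_apply, map_smul, LinearMap.smul_apply, smul_eq_mul]

theorem apply_eq_sum_right (b c : ι → ℤ) : f b c = ∑ i, c i * f b (unitVec i) := by
  conv_lhs => rw [eq_sum_unitVec c]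
  simp only [map_sum, map_smul, smul_eq_mul]

theorem level_eq_sum (β α : ι → ℤ) :
    level f k β α = ∑ i, α i * level f k β (unitVec i) := by
  simp only [level, mul_sub, Finset.sum_sub_distrib]
  rw [← apply_eq_sum_right]
  simp [Pi.single_apply]

theorem eq_of_forall_unitVec (hf : IsSimplyLacedForm f) {b c : ι → ℤ}
    (h : ∀ i, f b (unitVec i) = f c (unitVec i)) : b = c := by
  rw [← sub_eq_zero]
  apply hf.eq_zero_of_nonpos
  rw [apply_eq_sum_right]
  simp [h]

theorem even_apply_self (hf : IsSimplyLacedForm f) (b : ι → ℤ) : Even (f b b) := by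
  rw [eq_sum_unitVec b]
  induction (Finset.univ : Finset ι) using Finset.induction_on with
  | empty => simp
  | insert i s hi ih =>
    rw [Finset.sum_insert hi]
    generalize ∑ j ∈ s, b j • unitVec j = c at *
    have : f (b i • unitVec i + c) (b i • unitVec i + c) =
        2 * (b i * b i + b i * f (unitVec i) c) + f c c := by
      simp only [map_add, LinearMap.add_apply, map_smul, LinearMap.smul_apply, smul_eq_mul,
        hf.diag, hf.symm c (unitVec i)]
      ring
    rw [this]
    exact (even_two_mul _).add ih

theorem apply_nonpos_of_disjoint (hf : IsSimplyLacedForm f) {a b : ι → ℤ} (ha : 0 ≤ a)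
    (hb : 0 ≤ b) (h : ∀ i, a i = 0 ∨ b i = 0) : f a b ≤ 0 := by
  rw [apply_eq_sum]
  refine Finset.sum_nonpos fun i _ => ?_
  rw [apply_eq_sum_right, Finset.mul_sum]
  refine Finset.sum_nonpos fun j _ => ?_
  rcases eq_or_ne i j with rfl | hij
  · rcases h i with h | h <;> simp [h]
  · exact mul_nonpos_of_nonneg_of_nonpos (ha i)
      (mul_nonpos_of_nonneg_of_nonpos (hb j) (hf.off i j hij))

theorem apply_posPart_negPart_nonpos (hf : IsSimplyLacedForm f) (b : ι → ℤ) :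
    f (b⁺) (b⁻) ≤ 0 := by
  refine hf.apply_nonpos_of_disjoint (posPart_nonneg b) (negPart_nonneg b) fun i => ?_
  rw [Pi.posPart_apply, Pi.negPart_apply]
  rcases le_total (b i) 0 with h | h
  · exact Or.inl (posPart_of_nonpos h)
  · exact Or.inr (negPart_of_nonneg h)

/-- If both the positive and the negative part were nonzero, each would have even positive norm,
hence at least 2, and their mutual term can only increase the total, so the norm would be at least
4. -/
theorem nonneg_or_nonpos_of_root (hf : IsSimplyLacedForm f) {α : ι → ℤ} (hα : f α α = 2) :
    0 ≤ α ∨ α ≤ 0 := by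
  by_contra! h
  have h1 : α⁺ ≠ 0 := fun h' => h.2 (posPart_eq_zero.1 h')
  have h2 : α⁻ ≠ 0 := fun h' => h.1 (negPart_eq_zero.1 h')
  have h3 := hf.pos _ h1
  have h4 := hf.pos _ h2
  have h5 := hf.apply_posPart_negPart_nonpos α
  have h6 : f (α⁺ - α⁻) (α⁺ - α⁻) = 2 := by rwa [posPart_sub_negPart]
  simp only [map_sub, LinearMap.sub_apply, hf.symm (α⁻) (α⁺)] at h6
  obtain ⟨x, hx⟩ := hf.even_apply_self (α⁺)
  obtain ⟨y, hy⟩ := hf.even_apply_self (α⁻)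
  omega

/-- A positive root is a simple root or the sum of a simple and a positive root. -/
theorem exists_sub_root (hf : IsSimplyLacedForm f) {α : ι → ℤ} (hα : f α α = 2) (h0 : 0 ≤ α) :
    ∃ i, α = unitVec i ∨
      (f (α - unitVec i) (α - unitVec i) = 2 ∧ 0 ≤ α - unitVec i ∧ f α (unitVec i) = 1) := by
  -- The norm 2 is the sum of these terms, so one of them is positive.
  obtain ⟨i, hi⟩ : ∃ i, 0 < α i * f α (unitVec i) := by
    by_contra! h
    have := apply_eq_sum_right (f := f) α α
    have h1 := Finset.sum_nonpos fun i (_ : i ∈ Finset.univ) => h i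
    omega
  refine ⟨i, or_iff_not_imp_left.2 fun hne => ?_⟩
  have hαi : 0 < α i := (h0 i).lt_of_ne fun h => by simp [← h] at hi
  have h1 : 0 < f α (unitVec i) := pos_of_mul_pos_right hi hαi.le
  have h2 := hf.pos _ (sub_ne_zero.2 hne)
  have h3 : f (α - unitVec i) (α - unitVec i) = 4 - 2 * f α (unitVec i) := by
    simp only [map_sub, LinearMap.sub_apply, hf.symm (unitVec i) α, hα, hf.diag]; ring
  have h4 : f α (unitVec i) = 1 := by omega
  refine ⟨by omega, fun j => ?_, h4⟩
  rcases eq_or_ne j i with rfl | hj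
  · simp; omega
  · simpa [hj] using h0 j

/-- A root which is maximal among the roots below `β` pairs to at least `2` with `β`. -/
theorem exists_root_le (hf : IsSimplyLacedForm f) {β : ι → ℤ} (h0 : 0 ≤ β) (hβ : β ≠ 0) :
    ∃ θ, f θ θ = 2 ∧ 0 ≤ θ ∧ θ ≤ β ∧ 2 ≤ f θ β := by
  obtain ⟨j, hj⟩ := Function.ne_iff.1 hβ
  have hj' : 1 ≤ β j := (h0 j).lt_of_ne (Ne.symm hj)
  have hfin : {θ : ι → ℤ | f θ θ = 2 ∧ 0 ≤ θ ∧ θ ≤ β}.Finite :=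
    (Set.finite_Icc 0 β).subset fun θ h => ⟨h.2.1, h.2.2⟩
  obtain ⟨θ, ⟨⟨h1, h2, h3⟩, hmax⟩⟩ := hfin.exists_maximal ⟨unitVec j, hf.diag j,
    fun i => by rcases eq_or_ne i j with rfl | h <;> simp [*],
    fun i => by rcases eq_or_ne i j with rfl | h <;> simp [*]; exact h0 i⟩
  refine ⟨θ, h1, h2, h3, ?_⟩
  -- Where β exceeds θ, a simple root pairing negatively with θ could be added to give a larger root
  -- below β, against maximality.
  suffices 0 ≤ f θ (β - θ) by rw [map_sub, h1] at this; omega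
  rw [apply_eq_sum_right]
  refine Finset.sum_nonneg fun i _ => ?_
  rcases (h3 i).eq_or_lt with hi | hi
  · simp [hi]
  · refine mul_nonneg (by simpa using h3 i) ?_
    by_contra! hneg
    have hadd : f (θ + unitVec i) (θ + unitVec i) = 4 + 2 * f θ (unitVec i) := by
      simp only [map_add, LinearMap.add_apply, hf.symm (unitVec i) θ, h1, hf.diag]; ring
    have hge : 0 ≤ θ + unitVec i := fun j => by
      have := h2 j
      rcases eq_or_ne j i with rfl | h
      · simp_all; omega
      · simp_all
    have hpos := hf.pos (θ + unitVec i) fun h => by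
      have h4 := congrFun h i
      have h5 := h2 i
      simp at h4 h5
      omega
    have hle : θ + unitVec i ≤ β := fun j => by
      have := h3 j
      rcases eq_or_ne j i with rfl | h <;> simp_all
    have := hmax (y := θ + unitVec i) ⟨by omega, hge, hle⟩
      (fun j => by rcases eq_or_ne j i with rfl | h <;> simp [*]) i
    simp at this

theorem height_sub_unitVec (β : ι → ℤ) (i : ι) : height (β - unitVec i) = height β - 1 := by
  simp [height, Finset.sum_sub_distrib]

/-! ### Descent on the sphere when positive roots have coefficient at most 1 at k -/

section Minuscule

variable (hk : ∀ θ : ι → ℤ, f θ θ = 2 → 0 ≤ θ → θ k ≤ 1)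
include hk

/-- A maximal root θ ≤ β has f θ β ≥ 2 > θ_k, so β has positive level at θ. The level is additive in
the root, so it is positive at some simple root in the support of θ. -/
theorem exists_one_le_level (hf : IsSimplyLacedForm f) {β : ι → ℤ} (h0 : 0 ≤ β) (hβ : β ≠ 0) :
    ∃ i, 0 ≤ β - unitVec i ∧ 1 ≤ level f k β (unitVec i) := by
  obtain ⟨θ, h1, h2, h3, h4⟩ := hf.exists_root_le h0 hβ
  by_contra! h
  have h5 : f θ β ≤ θ k := by
    have h7 : level f k β θ ≤ 0 := by
      rw [level_eq_sum]
      refine Finset.sum_nonpos fun i _ => ?_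
      rcases (h2 i).eq_or_lt with hi | hi
      · simp [← hi]
      · refine mul_nonpos_of_nonneg_of_nonpos hi.le (Int.lt_add_one_iff.1 (h i fun j => ?_))
        have h8 : θ i ≤ β i := h3 i
        have h9 : 0 ≤ β j := h0 j
        replace hi : 0 < θ i := hi
        rcases eq_or_ne j i with rfl | hj
        · change 0 ≤ β j - (Pi.single j 1 : ι → ℤ) j
          rw [Pi.single_eq_same]
          omega
        · simpa [hj] using h9
    rw [level, hf.symm] at h7
    omega
  have := hk θ h1 h2
  omega

/-- Induction on the height: subtracting a simple root of level at least 1 does not increase the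
excess, and ends at 0. -/
theorem excess_nonneg_of_nonneg (hf : IsSimplyLacedForm f) {β : ι → ℤ} (h0 : 0 ≤ β) :
    0 ≤ excess f k β := by
  obtain ⟨n, hn⟩ : ∃ n : ℕ, height β = n :=
    ⟨(height β).toNat, (Int.toNat_of_nonneg (Finset.sum_nonneg fun i _ => h0 i)).symm⟩
  induction n generalizing β with
  | zero =>
    have : β = 0 := by
      ext i
      exact (Finset.sum_eq_zero_iff_of_nonneg fun i _ => h0 i).1 hn i (Finset.mem_univ i)
    simp [this, excess_zero]
  | succ n ih =>
    rcases eq_or_ne β 0 with rfl | hβ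
    · simp [excess_zero]
    obtain ⟨i, hi, hl⟩ := hf.exists_one_le_level hk h0 hβ
    have := ih hi (by rw [height_sub_unitVec, hn]; push_cast; ring)
    rw [hf.excess_sub_root (hf.diag i)] at this
    omega

/-- This is what makes effectivity of the curves automatic. With β = β⁺ - β⁻, the excess is
excess(β⁺) - 2f(β⁺, β⁻) + 2(β⁻)_k + f(β⁻, β⁻), a sum of nonnegative terms, so β⁻ has norm 0. -/
theorem nonneg_of_excess_eq_zero (hf : IsSimplyLacedForm f) {β : ι → ℤ}
    (h : excess f k β = 0) : 0 ≤ β := by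
  rw [← negPart_eq_zero]
  apply hf.eq_zero_of_nonpos
  have h1 := hf.excess_nonneg_of_nonneg hk (posPart_nonneg β)
  have h2 := hf.apply_posPart_negPart_nonpos β
  rw [← posPart_sub_negPart β, sub_eq_add_neg, hf.excess_add, level_neg_right, level] at h
  have h3 : 0 ≤ (β⁻) k := negPart_nonneg β k
  simp only [map_neg, LinearMap.neg_apply, neg_neg] at h
  omega

/-- Subtracting a simple root of level l ≥ 1 leaves excess 2 - 2l, which cannot be negative; so l =
1. -/
theorem exists_level_eq_one (hf : IsSimplyLacedForm f) {β : ι → ℤ}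
    (h : excess f k β = 0) (hβ : β ≠ 0) :
    ∃ i, excess f k (β - unitVec i) = 0 ∧ level f k β (unitVec i) = 1 := by
  obtain ⟨i, hi, hl⟩ := hf.exists_one_le_level hk (hf.nonneg_of_excess_eq_zero hk h) hβ
  have h1 := hf.excess_nonneg_of_nonneg hk hi
  have h2 := hf.excess_sub_root (k := k) (hf.diag i) β
  exact ⟨i, by omega, by omega⟩

end Minuscule

end IsSimplyLacedForm

end Form

end ADESurface

namespace ADESurface

/-! ### Representations with the weights of a minuscule representation -/

section Rep

variable {ι : Type*} [Fintype ι] [DecidableEq ι]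

/-- A Chevalley basis with respect to the root system of the form `f` on `ℤ^ι`. The value of `X` at
a vector which is not a root is irrelevant. -/
structure LatticeChevalleyBasis (f : LinearMap.BilinForm ℤ (ι → ℤ)) (𝔤 : Type*) [LieRing 𝔤]
    [LieAlgebra ℂ 𝔤] where
  /-- The basis of the Cartan subalgebra. -/
  h : ι → 𝔤
  /-- The root vectors. -/
  X : (ι → ℤ) → 𝔤
  lie_h_h : ∀ i j, ⁅h i, h j⁆ = 0
  lie_h_X : ∀ i α, f α α = 2 → ⁅h i, X α⁆ = (f α (unitVec i) : ℂ) • X α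
  lie_X_neg : ∀ α, f α α = 2 → ⁅X α, X (-α)⁆ = ∑ i, (α i : ℂ) • h i
  lie_X_add : ∀ α β, f α α = 2 → f β β = 2 → f (α + β) (α + β) = 2 →
    ⁅X α, X β⁆ = X (α + β) ∨ ⁅X α, X β⁆ = -X (α + β)
  lie_X_zero : ∀ α β, f α α = 2 → f β β = 2 → α + β ≠ 0 → f (α + β) (α + β) ≠ 2 →
    ⁅X α, X β⁆ = 0
  span_eq_top : Submodule.span ℂ (Set.range h ∪ X '' {α | f α α = 2}) = ⊤

variable {f : LinearMap.BilinForm ℤ (ι → ℤ)} {𝔤 : Type*} [LieRing 𝔤] [LieAlgebra ℂ 𝔤]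

/-- Every positive root is built by adding simple roots one at a time through roots, and each
addition is, up to sign, a bracket; the same holds for the negatives. -/
theorem LatticeChevalleyBasis.eq_top_of_mem (B : LatticeChevalleyBasis f 𝔤)
    (hf : IsSimplyLacedForm f) (S : LieSubalgebra ℂ 𝔤) (hh : ∀ i, B.h i ∈ S)
    (hX : ∀ i, B.X (unitVec i) ∈ S) (hX' : ∀ i, B.X (-unitVec i) ∈ S) (g : 𝔤) : g ∈ S := by
  have hadd : ∀ α β, f α α = 2 → f β β = 2 → f (α + β) (α + β) = 2 → B.X α ∈ S → B.X β ∈ S →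
      B.X (α + β) ∈ S := by
    intro α β h1 h2 h3 h4 h5
    rcases B.lie_X_add α β h1 h2 h3 with h | h
    · rw [← h]; exact S.lie_mem h4 h5
    · rw [← neg_neg (B.X (α + β)), ← h]; exact S.neg_mem (S.lie_mem h4 h5)
  have hneg : ∀ β : ι → ℤ, f (-β) (-β) = f β β := fun β => by simp
  have hpos : ∀ n : ℕ, ∀ α : ι → ℤ, f α α = 2 → 0 ≤ α → height α = n →
      B.X α ∈ S ∧ B.X (-α) ∈ S := by
    intro n
    induction n with
    | zero =>
      intro α hα h0 hn
      refine absurd ?_ (ne_zero_of_root hα)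
      ext i
      exact (Finset.sum_eq_zero_iff_of_nonneg fun i _ => h0 i).1 hn i (Finset.mem_univ i)
    | succ n ih =>
      intro α hα h0 hn
      obtain ⟨i, rfl | ⟨h1, h2, h3⟩⟩ := hf.exists_sub_root hα h0
      · exact ⟨hX i, hX' i⟩
      · obtain ⟨h4, h5⟩ := ih _ h1 h2 (by
          rw [IsSimplyLacedForm.height_sub_unitVec, hn]; push_cast; ring)
        have e1 : α - unitVec i + unitVec i = α := by abel
        have e2 : -(α - unitVec i) + -unitVec i = -α := by abel
        constructor
        · have := hadd (α - unitVec i) (unitVec i) h1 (hf.diag i) (by rwa [e1]) h4 (hX i)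
          rwa [e1] at this
        · have := hadd (-(α - unitVec i)) (-unitVec i) (by rw [hneg, h1])
            (by rw [hneg, hf.diag]) (by rw [e2]; simpa using hα) h5 (hX' i)
          rwa [e2] at this
  have hall : ∀ α : ι → ℤ, f α α = 2 → B.X α ∈ S := by
    intro α hα
    rcases hf.nonneg_or_nonpos_of_root hα with h0 | h0
    · exact (hpos _ α hα h0
        (Int.toNat_of_nonneg (Finset.sum_nonneg fun i _ => h0 i)).symm).1
    · have h1 : 0 ≤ -α := neg_nonneg.2 h0
      have := (hpos _ (-α) (by simpa using hα) h1
        (Int.toNat_of_nonneg (Finset.sum_nonneg fun i _ => h1 i)).symm).2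
      rwa [neg_neg] at this
  have : (⊤ : Submodule ℂ 𝔤) ≤ S.toSubmodule := by
    rw [← B.span_eq_top, Submodule.span_le]
    rintro _ (⟨i, rfl⟩ | ⟨α, hα, rfl⟩)
    · exact hh i
    · exact hall α hα
  exact this Submodule.mem_top

variable {M : Type*} [AddCommGroup M] [Module ℂ M]

/-- The vector `v` has the weight `β - ω_k`. -/
def HasLatticeWeight (B : LatticeChevalleyBasis f 𝔤) (ρ : 𝔤 →ₗ[ℂ] M →ₗ[ℂ] M) (k : ι)
    (β : ι → ℤ) (v : M) : Prop :=
  ∀ i, ρ (B.h i) v = (level f k β (unitVec i) : ℂ) • v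

/-- `ρ` is an action of `𝔤` whose weights in the coset of `-ω_k` have the same norm as `-ω_k`, and
`-ω_k` is one of them. -/
structure IsMinusculeAction (B : LatticeChevalleyBasis f 𝔤) (ρ : 𝔤 →ₗ[ℂ] M →ₗ[ℂ] M) (k : ι) :
    Prop where
  lie : ∀ x y v, ρ ⁅x, y⁆ v = ρ x (ρ y v) - ρ y (ρ x v)
  exists_weight : ∃ v, v ≠ 0 ∧ HasLatticeWeight B ρ k 0 v
  excess_eq : ∀ β v, v ≠ 0 → HasLatticeWeight B ρ k β v → excess f k β = 0

variable {B : LatticeChevalleyBasis f 𝔤} {ρ : 𝔤 →ₗ[ℂ] M →ₗ[ℂ] M} {k : ι}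

theorem HasLatticeWeight.sum_smul {β : ι → ℤ} {v : M} (hv : HasLatticeWeight B ρ k β v)
    (α : ι → ℤ) : ρ (∑ i, (α i : ℂ) • B.h i) v = (level f k β α : ℂ) • v := by
  rw [IsSimplyLacedForm.level_eq_sum]
  simp only [map_sum, LinearMap.sum_apply, map_smul, LinearMap.smul_apply, hv _,
    Int.cast_sum, Int.cast_mul, Finset.sum_smul, mul_smul]

/-! ### Root vectors on weight vectors -/

namespace IsMinusculeAction

theorem weight_root (h : IsMinusculeAction B ρ k) {α β : ι → ℤ} {v : M} (hα : f α α = 2)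
    (hv : HasLatticeWeight B ρ k β v) : HasLatticeWeight B ρ k (β + α) (ρ (B.X α) v) := by
  intro i
  have h1 := h.lie (B.h i) (B.X α) v
  rw [B.lie_h_X i α hα, hv i] at h1
  simp only [map_smul, LinearMap.smul_apply] at h1
  rw [level_add_left, Int.cast_add, add_smul, h1]
  abel

/-- A nonzero image would have weight β + α - ω_k, whose excess is 2 · level + 2. -/
theorem root_eq_zero (hf : IsSimplyLacedForm f) (h : IsMinusculeAction B ρ k) {α β : ι → ℤ}
    {v : M} (hα : f α α = 2) (hv : HasLatticeWeight B ρ k β v) (hl : level f k β α ≠ -1) :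
    ρ (B.X α) v = 0 := by
  by_contra hne
  have h0 : v ≠ 0 := by rintro rfl; simp at hne
  have h1 := h.excess_eq _ _ hne (h.weight_root hα hv)
  rw [hf.excess_add_root hα, h.excess_eq _ _ h0 hv] at h1
  omega

theorem root_neg_root (hf : IsSimplyLacedForm f) (h : IsMinusculeAction B ρ k) {α β : ι → ℤ}
    {v : M} (hα : f α α = 2) (hv : HasLatticeWeight B ρ k β v) (hl : level f k β α = -1) :
    ρ (B.X (-α)) (ρ (B.X α) v) = v := by
  have h1 := h.lie (B.X α) (B.X (-α)) v
  rw [B.lie_X_neg α hα, hv.sum_smul, h.root_eq_zero hf (α := -α) (by simpa using hα) hv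
    (by rw [level_neg_right]; omega), hl] at h1
  simpa using h1.symm

/-- At a level other than ±1 both X_α and X_{-α} kill `v`, so their bracket, the coroot, acts by 0.
-/
theorem level_mem (hf : IsSimplyLacedForm f) (h : IsMinusculeAction B ρ k) {α β : ι → ℤ}
    {v : M} (hα : f α α = 2) (hv : HasLatticeWeight B ρ k β v) (h0 : v ≠ 0) :
    level f k β α = -1 ∨ level f k β α = 0 ∨ level f k β α = 1 := by
  by_contra! hl
  have h1 := h.lie (B.X α) (B.X (-α)) v
  rw [B.lie_X_neg α hα, hv.sum_smul, h.root_eq_zero hf (α := -α) (by simpa using hα) hv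
    (by rw [level_neg_right]; omega), h.root_eq_zero hf hα hv hl.1] at h1
  simp only [map_zero, sub_zero, smul_eq_zero, Int.cast_eq_zero, h0, or_false] at h1
  exact hl.2.1 h1

/-- The lowest weight has level -θ_k at θ. This is the hypothesis that drives the lattice descent.
-/
theorem root_apply_le_one (hf : IsSimplyLacedForm f) (h : IsMinusculeAction B ρ k) :
    ∀ θ : ι → ℤ, f θ θ = 2 → 0 ≤ θ → θ k ≤ 1 := by
  intro θ hθ _
  obtain ⟨v, h0, hv⟩ := h.exists_weight
  have := h.level_mem hf hθ hv h0
  rw [level_zero_left] at this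
  omega

end IsMinusculeAction

/-- A family of weight vectors which the simple root vectors map to each other. -/
structure IsWeightFamily (B : LatticeChevalleyBasis f 𝔤) (ρ : 𝔤 →ₗ[ℂ] M →ₗ[ℂ] M) (k : ι)
    (w : (ι → ℤ) → M) : Prop where
  ne_zero : ∀ β, excess f k β = 0 → w β ≠ 0
  weight : ∀ β, excess f k β = 0 → HasLatticeWeight B ρ k β (w β)
  root : ∀ β i, excess f k β = 0 → excess f k (β - unitVec i) = 0 →
    ρ (B.X (unitVec i)) (w (β - unitVec i)) = w β

/-- Each β is reached from 0 along a chosen path of simple roots. Two last steps i ≠ j into the same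
β commute, so by induction the resulting vector does not depend on the path. -/
theorem IsMinusculeAction.exists_weightFamily (hf : IsSimplyLacedForm f)
    (h : IsMinusculeAction B ρ k) : ∃ w, IsWeightFamily B ρ k w := by
  have hk := h.root_apply_le_one hf
  have hpick : ∀ β : ι → ℤ, ∃ i, excess f k β = 0 → β ≠ 0 →
      excess f k (β - unitVec i) = 0 ∧ level f k β (unitVec i) = 1 := by
    intro β
    by_cases hβ : excess f k β = 0 ∧ β ≠ 0
    · obtain ⟨i, hi⟩ := hf.exists_level_eq_one hk hβ.1 hβ.2
      exact ⟨i, fun _ _ => hi⟩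
    · exact ⟨k, fun h1 h2 => absurd ⟨h1, h2⟩ hβ⟩
  choose pick hpick using hpick
  obtain ⟨v₀, hv₀, hw₀⟩ := h.exists_weight
  -- The recursion runs on the height; only nonnegative heights occur on the sphere, so truncation
  -- by `toNat` is harmless.
  let W : ℕ → (ι → ℤ) → M := Nat.rec (fun _ => v₀) fun _ r β =>
    ρ (B.X (unitVec (pick β))) (r (β - unitVec (pick β)))
  let w : (ι → ℤ) → M := fun β => W (height β).toNat β
  have hheight : ∀ (n : ℕ) (β : ι → ℤ) i, height β = ((n + 1 : ℕ) : ℤ) →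
      height (β - unitVec i) = n := by
    intro n β i hn
    rw [IsSimplyLacedForm.height_sub_unitVec, hn]; push_cast; ring
  have hwW : ∀ (n : ℕ) (β : ι → ℤ), height β = n → w β = W n β := by
    intro n β hn
    simp only [w, hn, Int.toNat_natCast]
  have hwpick : ∀ (n : ℕ) (β : ι → ℤ), height β = ((n + 1 : ℕ) : ℤ) →
      w β = ρ (B.X (unitVec (pick β))) (w (β - unitVec (pick β))) := by
    intro n β hn
    rw [hwW _ _ hn, hwW _ _ (hheight n β _ hn)]
  have hzero : ∀ β : ι → ℤ, excess f k β = 0 → height β = 0 → β = 0 := by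
    intro β hβ hn
    ext i
    exact (Finset.sum_eq_zero_iff_of_nonneg
      fun i _ => hf.nonneg_of_excess_eq_zero hk hβ i).1 hn i (Finset.mem_univ i)
  have hlevel : ∀ (β : ι → ℤ) i, excess f k β = 0 → excess f k (β - unitVec i) = 0 →
      level f k β (unitVec i) = 1 := by
    intro β i h1 h2
    rw [hf.excess_sub_root (hf.diag i)] at h2
    omega
  have main : ∀ (n : ℕ) (β : ι → ℤ), excess f k β = 0 → height β = n →
      w β ≠ 0 ∧ HasLatticeWeight B ρ k β (w β) ∧
      ∀ i, excess f k (β - unitVec i) = 0 →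
        ρ (B.X (unitVec i)) (w (β - unitVec i)) = w β := by
    intro n
    induction n with
    | zero =>
      intro β hβ hn
      obtain rfl := hzero β hβ hn
      rw [hwW 0 _ hn]
      refine ⟨hv₀, hw₀, fun i hi => ?_⟩
      have := hf.nonneg_of_excess_eq_zero hk hi i
      simp at this
    | succ n ih =>
      intro β hβ hn
      have hβ0 : β ≠ 0 := by
        rintro rfl
        simp [height] at hn
        omega
      obtain ⟨hi, hli⟩ := hpick β hβ hβ0
      have hwi := hwpick n β hn
      generalize pick β = i at hi hli hwi
      obtain ⟨h1, h2, h3⟩ := ih _ hi (hheight n β i hn)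
      have hl : level f k (β - unitVec i) (unitVec i) = -1 := by
        rw [level_sub_left, hli, hf.diag]; norm_num
      have hne : w β ≠ 0 := by
        rw [hwi]
        intro h0
        have := h.root_neg_root hf (hf.diag i) h2 hl
        rw [h0, map_zero] at this
        exact h1 this.symm
      have hwt : HasLatticeWeight B ρ k β (w β) := by
        have := h.weight_root (hf.diag i) h2
        rwa [← hwi, sub_add_cancel] at this
      refine ⟨hne, hwt, fun j hj => ?_⟩
      rcases eq_or_ne i j with rfl | hij
      · exact hwi.symm
      have hlj := hlevel β j hβ hj
      have hsum : f (unitVec i + unitVec j) (unitVec i + unitVec j) =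
          4 + 2 * f (unitVec i) (unitVec j) := by
        simp only [map_add, LinearMap.add_apply, hf.symm (unitVec j) (unitVec i), hf.diag]; ring
      -- Otherwise α_i + α_j is a root at which β has level 1 + 1 = 2, which is impossible.
      have horth : f (unitVec i) (unitVec j) = 0 := by
        refine (hf.apply_unitVec_eq hij).resolve_right fun h' => ?_
        have := h.level_mem hf (α := unitVec i + unitVec j) (by rw [hsum, h']; norm_num) hwt hne
        rw [level_add_right, hli, hlj] at this
        omega
      have hγ : excess f k (β - unitVec i - unitVec j) = 0 := by
        rw [hf.excess_sub_root (hf.diag j), hi, level_sub_left, hlj, horth]; norm_num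
      have hγ' : β - unitVec i - unitVec j = β - unitVec j - unitVec i := by abel
      have e1 := h3 j hγ
      have e2 := (ih _ hj (hheight n β j hn)).2.2 i (by rwa [← hγ'])
      have hcomm := h.lie (B.X (unitVec i)) (B.X (unitVec j)) (w (β - unitVec i - unitVec j))
      rw [B.lie_X_zero _ _ (hf.diag i) (hf.diag j) (fun h' => by
        have := congrFun h' i
        simp [hij] at this) (by rw [hsum, horth]; norm_num), map_zero,
        LinearMap.zero_apply] at hcomm
      rw [← e2, hwi, ← e1, ← hγ']
      exact (sub_eq_zero.1 hcomm.symm).symm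
  have hn : ∀ β : ι → ℤ, excess f k β = 0 →
      height β = ((height β).toNat : ℤ) := fun β hβ =>
    (Int.toNat_of_nonneg
      (Finset.sum_nonneg fun i _ => hf.nonneg_of_excess_eq_zero hk hβ i)).symm
  exact ⟨w, fun β hβ => (main _ β hβ (hn β hβ)).1, fun β hβ => (main _ β hβ (hn β hβ)).2.1,
    fun β i hβ hi => (main _ β hβ (hn β hβ)).2.2 i hi⟩

/-! ### Signs, independence and comparison of weight families -/

namespace IsWeightFamily

variable {w : (ι → ℤ) → M}

theorem root_eq_zero (hf : IsSimplyLacedForm f) (h : IsMinusculeAction B ρ k)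
    (hw : IsWeightFamily B ρ k w) {α β : ι → ℤ} (hα : f α α = 2) (hβ : excess f k β = 0)
    (hβα : excess f k (β + α) ≠ 0) : ρ (B.X α) (w β) = 0 := by
  refine h.root_eq_zero hf hα (hw.weight β hβ) fun hl => hβα ?_
  rw [hf.excess_add_root hα, hβ, hl]; norm_num

theorem neg_root (hf : IsSimplyLacedForm f) (h : IsMinusculeAction B ρ k)
    (hw : IsWeightFamily B ρ k w) {β : ι → ℤ} {i : ι} (hβ : excess f k β = 0)
    (hi : excess f k (β - unitVec i) = 0) :
    ρ (B.X (-unitVec i)) (w β) = w (β - unitVec i) := by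
  rw [← hw.root β i hβ hi]
  refine h.root_neg_root hf (hf.diag i) (hw.weight _ hi) ?_
  rw [hf.excess_sub_root (hf.diag i)] at hi
  rw [level_sub_left, hf.diag]
  omega

/-- Write α = γ + α_i, so X_α = ±[X_γ, X_{α_i}]. The level -1 at α splits as (-1, 0) or (0, -1)
between γ and α_i, so exactly one of the two composites survives and induction applies to X_γ. -/
theorem root_pos (hf : IsSimplyLacedForm f) (h : IsMinusculeAction B ρ k)
    (hw : IsWeightFamily B ρ k w) (n : ℕ) {α β : ι → ℤ} (hα : f α α = 2) (h0 : 0 ≤ α)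
    (hn : height α = n) (hβ : excess f k β = 0)
    (hβα : excess f k (β + α) = 0) :
    ρ (B.X α) (w β) = w (β + α) ∨ ρ (B.X α) (w β) = -w (β + α) := by
  induction n generalizing α β with
  | zero =>
    refine absurd ?_ (ne_zero_of_root hα)
    ext i
    exact (Finset.sum_eq_zero_iff_of_nonneg fun i _ => h0 i).1 hn i (Finset.mem_univ i)
  | succ n ih =>
    have hsimple : ∀ β i, excess f k β = 0 → excess f k (β + unitVec i) = 0 →
        ρ (B.X (unitVec i)) (w β) = w (β + unitVec i) := by
      intro β i h1 h2
      have := hw.root (β + unitVec i) i h2 (by rwa [add_sub_cancel_right])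
      rwa [add_sub_cancel_right] at this
    obtain ⟨i, rfl | ⟨h1, h2, h3⟩⟩ := hf.exists_sub_root hα h0
    · exact Or.inl (hsimple β i hβ hβα)
    · have hn' : height (α - unitVec i) = n := by
        rw [IsSimplyLacedForm.height_sub_unitVec, hn]; push_cast; ring
      have hl : level f k β α = -1 := by
        rw [hf.excess_add_root hα] at hβα
        omega
      obtain ⟨γ, rfl⟩ : ∃ γ, α = γ + unitVec i := ⟨α - unitVec i, by abel⟩
      simp only [add_sub_cancel_right] at h1 h2 hn'
      have hl1 := h.level_mem hf h1 (hw.weight β hβ) (hw.ne_zero β hβ)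
      have hl2 := h.level_mem hf (hf.diag i) (hw.weight β hβ) (hw.ne_zero β hβ)
      rw [level_add_right] at hl
      have hlie := h.lie (B.X γ) (B.X (unitVec i)) (w β)
      have key : ρ ⁅B.X γ, B.X (unitVec i)⁆ (w β) = w (β + (γ + unitVec i)) ∨
          ρ ⁅B.X γ, B.X (unitVec i)⁆ (w β) = -w (β + (γ + unitVec i)) := by
        have hγi : f γ (unitVec i) = -1 := by
          simp only [map_add, LinearMap.add_apply, hf.diag] at h3
          omega
        rcases hl1 with hl1 | hl1 | hl1
        · have hl2 : level f k β (unitVec i) = 0 := by omega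
          rw [hlie, h.root_eq_zero hf (hf.diag i) (hw.weight β hβ) (by omega), map_zero, zero_sub]
          have hγ : excess f k (β + γ) = 0 := by
            rw [hf.excess_add_root h1]; omega
          have := hsimple (β + γ) i hγ (by rwa [add_assoc])
          rw [add_assoc] at this
          rcases ih h1 h2 hn' hβ hγ with h' | h' <;> simp [h', this]
        · have hl2 : level f k β (unitVec i) = -1 := by omega
          have hγ : excess f k (β + unitVec i) = 0 := by
            rw [hf.excess_add_root (hf.diag i)]; omega
          rw [hlie, h.root_eq_zero hf h1 (hw.weight β hβ) (by omega), map_zero, sub_zero,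
            hsimple β i hβ hγ]
          have e : β + unitVec i + γ = β + (γ + unitVec i) := by abel
          have := ih (β := β + unitVec i) h1 h2 hn' hγ (by rwa [e])
          rwa [e] at this
        · omega
      rcases B.lie_X_add γ (unitVec i) h1 (hf.diag i) hα with h' | h' <;> rw [h'] at key
      · exact key
      · simp only [map_neg, LinearMap.neg_apply, neg_inj] at key
        rw [neg_eq_iff_eq_neg] at key
        exact key.symm

/-- For a negative root, the opposite positive root vector acts by a sign in the other direction and
is inverted by `root_neg_root`. -/
theorem root_sign (hf : IsSimplyLacedForm f) (h : IsMinusculeAction B ρ k)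
    (hw : IsWeightFamily B ρ k w) {α β : ι → ℤ} (hα : f α α = 2) (hβ : excess f k β = 0)
    (hβα : excess f k (β + α) = 0) :
    ∃ ε : ℤˣ, ρ (B.X α) (w β) = ((ε : ℤ) : ℂ) • w (β + α) := by
  suffices ρ (B.X α) (w β) = w (β + α) ∨ ρ (B.X α) (w β) = -w (β + α) by
    rcases this with h | h
    · exact ⟨1, by simp [h]⟩
    · exact ⟨-1, by simp [h]⟩
  rcases hf.nonneg_or_nonpos_of_root hα with h0 | h0
  · exact hw.root_pos hf h _ hα h0
      (Int.toNat_of_nonneg (Finset.sum_nonneg fun i _ => h0 i)).symm hβ hβα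
  · have h1 : 0 ≤ -α := neg_nonneg.2 h0
    have hα' : f (-α) (-α) = 2 := by simpa using hα
    have h2 := hw.root_pos hf h _ hα' h1
      (Int.toNat_of_nonneg (Finset.sum_nonneg fun i _ => h1 i)).symm hβα
      (by rwa [add_neg_cancel_right])
    have h3 := h.root_neg_root hf hα' (hw.weight _ hβα) (by
      rw [hf.excess_add_root hα] at hβα
      rw [level_neg_right, level_add_left, hα]
      omega)
    rw [add_neg_cancel_right] at h2
    rw [neg_neg] at h3
    rcases h2 with h2 | h2 <;> rw [h2] at h3
    · exact Or.inl h3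
    · rw [map_neg] at h3
      exact Or.inr (neg_eq_iff_eq_neg.1 h3)

theorem apply_mem_span (hf : IsSimplyLacedForm f) (h : IsMinusculeAction B ρ k)
    (hw : IsWeightFamily B ρ k w) (g : 𝔤) {v : M}
    (hv : v ∈ Submodule.span ℂ (w '' {β | excess f k β = 0})) :
    ρ g v ∈ Submodule.span ℂ (w '' {β | excess f k β = 0}) := by
  have hg : g ∈ Submodule.span ℂ (Set.range B.h ∪ B.X '' {α | f α α = 2}) := by
    rw [B.span_eq_top]; trivial
  induction hg using Submodule.span_induction with
  | zero => simp
  | add x y _ _ hx hy => simpa using Submodule.add_mem _ hx hy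
  | smul c x _ hx => simpa using Submodule.smul_mem _ c hx
  | mem x hx =>
    induction hv using Submodule.span_induction with
    | zero => simp
    | add y z _ _ hy hz => simpa using Submodule.add_mem _ hy hz
    | smul c y _ hy => simpa using Submodule.smul_mem _ c hy
    | mem y hy =>
      obtain ⟨β, hβ, rfl⟩ := hy
      rcases hx with ⟨i, rfl⟩ | ⟨α, hα, rfl⟩
      · rw [hw.weight β hβ i]
        exact Submodule.smul_mem _ _ (Submodule.subset_span ⟨β, hβ, rfl⟩)
      · by_cases hβα : excess f k (β + α) = 0
        · obtain ⟨ε, hε⟩ := hw.root_sign hf h hα hβ hβα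
          rw [hε]
          exact Submodule.smul_mem _ _ (Submodule.subset_span ⟨_, hβα, rfl⟩)
        · rw [hw.root_eq_zero hf h hα hβ hβα]
          exact Submodule.zero_mem _

/-- Simultaneous eigenvectors of the commuting `h i`, with distinct eigenvalues because the form is
nondegenerate. -/
theorem linearIndependent (hf : IsSimplyLacedForm f) (h : IsMinusculeAction B ρ k)
    (hw : IsWeightFamily B ρ k w) :
    LinearIndependent ℂ fun β : {β : ι → ℤ // excess f k β = 0} => w β := by
  have hcomm : Pairwise fun i j => Commute (ρ (B.h i)) (ρ (B.h j)) := by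
    intro i j _
    ext v
    have := h.lie (B.h i) (B.h j) v
    rw [B.lie_h_h, map_zero, LinearMap.zero_apply] at this
    exact sub_eq_zero.1 this.symm
  have hind := Module.End.independent_iInf_maxGenEigenspace_of_forall_mapsTo
    (fun i => ρ (B.h i)) (fun i j μ => Module.End.mapsTo_maxGenEigenspace_of_comm
      (by rcases eq_or_ne i j with rfl | hij
          · exact Commute.refl _
          · exact (hcomm hij.symm)) μ)
  let χ : {β : ι → ℤ // excess f k β = 0} → ι → ℂ := fun β i => level f k β.1 (unitVec i)
  have hχ : Function.Injective χ := by
    intro β γ hβγ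
    refine Subtype.ext (hf.eq_of_forall_unitVec fun i => ?_)
    have := congrFun hβγ i
    simp only [χ, level, Int.cast_inj] at this
    omega
  refine (hind.comp hχ).linearIndependent _ (fun β => ?_) fun β => hw.ne_zero _ β.2
  simp only [Function.comp, Submodule.mem_iInf]
  intro i
  exact Module.End.eigenspace_le_maxGenEigenspace
    (Module.End.mem_eigenspace_iff.2 (hw.weight _ β.2 i))

/-- A linear map between minuscule actions which maps a weight family to a weight family is
equivariant. -/
theorem equivariant (hf : IsSimplyLacedForm f) (h : IsMinusculeAction B ρ k)
    (hw : IsWeightFamily B ρ k w)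
    (hspan : Submodule.span ℂ (w '' {β | excess f k β = 0}) = ⊤)
    {M' : Type*} [AddCommGroup M'] [Module ℂ M'] {ρ' : 𝔤 →ₗ[ℂ] M' →ₗ[ℂ] M'}
    (h' : IsMinusculeAction B ρ' k) {w' : (ι → ℤ) → M'} (hw' : IsWeightFamily B ρ' k w')
    (Ψ : M →ₗ[ℂ] M') (hΨ : ∀ β, excess f k β = 0 → Ψ (w β) = w' β) (g : 𝔤) (v : M) :
    Ψ (ρ g v) = ρ' g (Ψ v) := by
  -- Elements intertwined by Ψ form a Lie subalgebra, so generators suffice; on these both families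
  -- have the same coefficients, without signs.
  let S : LieSubalgebra ℂ 𝔤 :=
    { carrier := {g | ∀ v, Ψ (ρ g v) = ρ' g (Ψ v)}
      add_mem' := fun {a b} ha hb v => by simp [ha v, hb v]
      zero_mem' := fun v => by simp
      smul_mem' := fun c a ha v => by simp [ha v]
      lie_mem' := fun {a b} ha hb v => by
        rw [h.lie, h'.lie, map_sub, ha, hb, hb, ha] }
  have hS : ∀ g, (∀ β, excess f k β = 0 → Ψ (ρ g (w β)) = ρ' g (w' β)) → g ∈ S := by
    intro g hg v
    have hv : v ∈ Submodule.span ℂ (w '' {β | excess f k β = 0}) := by rw [hspan]; trivial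
    induction hv using Submodule.span_induction with
    | zero => simp
    | add y z _ _ hy hz => simp [hy, hz]
    | smul c y _ hy => simp [hy]
    | mem y hy =>
      obtain ⟨β, hβ, rfl⟩ := hy
      rw [hg β hβ, hΨ β hβ]
  refine B.eq_top_of_mem hf S (fun i => hS _ fun β hβ => ?_) (fun i => hS _ fun β hβ => ?_)
    (fun i => hS _ fun β hβ => ?_) g v
  · rw [hw.weight β hβ, hw'.weight β hβ, map_smul, hΨ β hβ]
  · by_cases hi : excess f k (β + unitVec i) = 0
    · have e1 := hw.root _ i hi (by rwa [add_sub_cancel_right])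
      have e2 := hw'.root _ i hi (by rwa [add_sub_cancel_right])
      rw [add_sub_cancel_right] at e1 e2
      rw [e1, e2, hΨ _ hi]
    · rw [hw.root_eq_zero hf h (hf.diag i) hβ hi, hw'.root_eq_zero hf h' (hf.diag i) hβ hi,
        map_zero]
  · by_cases hi : excess f k (β - unitVec i) = 0
    · rw [hw.neg_root hf h hβ hi, hw'.neg_root hf h' hβ hi, hΨ _ hi]
    · have hd : f (-unitVec i) (-unitVec i) = 2 := by
        simpa only [map_neg, LinearMap.neg_apply, neg_neg] using hf.diag i
      rw [sub_eq_add_neg] at hi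
      rw [hw.root_eq_zero hf h hd hβ hi, hw'.root_eq_zero hf h' hd hβ hi, map_zero]

end IsWeightFamily

end Rep

end ADESurface

noncomputable section

namespace ADESurface

/-! ### Analytic subsets -/

section AnalyticSubsets

variable {Y : Type*} [TopologicalSpace Y] [ChartedSpace (EuclideanSpace ℂ (Fin 2)) Y]

theorem IsAnalyticSubset.inter {A B : Set Y} (hA : IsAnalyticSubset (HolAt (Y := Y)) A)
    (hB : IsAnalyticSubset (HolAt (Y := Y)) B) : IsAnalyticSubset (HolAt (Y := Y)) (A ∩ B) := by
  intro x
  obtain ⟨U, hU, hxU, m, f, hf, hfA⟩ := hA x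
  obtain ⟨W, hW, hxW, n, g, hg, hgB⟩ := hB x
  refine ⟨U ∩ W, hU.inter hW, ⟨hxU, hxW⟩, m + n, fun j => Sum.elim f g (finSumFinEquiv.symm j),
    fun j y hy => ?_, fun y hy => ?_⟩
  · beta_reduce
    rcases finSumFinEquiv.symm j with i | i
    · exact hf i y hy.1
    · exact hg i y hy.2
  · rw [Set.mem_inter_iff, hfA y hy.1, hgB y hy.2, finSumFinEquiv.symm.forall_congr_left]
    simp

theorem IsAnalyticSubset.union {A B : Set Y} (hA : IsAnalyticSubset (HolAt (Y := Y)) A)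
    (hB : IsAnalyticSubset (HolAt (Y := Y)) B) : IsAnalyticSubset (HolAt (Y := Y)) (A ∪ B) := by
  intro x
  obtain ⟨U, hU, hxU, m, f, hf, hfA⟩ := hA x
  obtain ⟨W, hW, hxW, n, g, hg, hgB⟩ := hB x
  refine ⟨U ∩ W, hU.inter hW, ⟨hxU, hxW⟩, m * n, fun j y => f (finProdFinEquiv.symm j).1 y *
    g (finProdFinEquiv.symm j).2 y, fun j y hy => ?_, fun y hy => ?_⟩
  · exact ContMDiffAt.mul (hf _ y hy.1) (hg _ y hy.2)
  · rw [Set.mem_union, hfA y hy.1, hgB y hy.2]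
    constructor
    · rintro (h | h) j <;> simp [h]
    · intro h
      by_contra! hne
      obtain ⟨⟨i, hi⟩, ⟨j, hj⟩⟩ := hne
      have := h (finProdFinEquiv (i, j))
      simp [hi, hj] at this

theorem isAnalyticSubset_empty : IsAnalyticSubset (HolAt (Y := Y)) (∅ : Set Y) := fun x =>
  ⟨Set.univ, isOpen_univ, trivial, 1, fun _ _ => 1, fun _ _ _ => contMDiffAt_const, by simp⟩

theorem IsAnalyticSubset.biUnion {ι : Type*} (s : Finset ι) (A : ι → Set Y)
    (hA : ∀ i, IsAnalyticSubset (HolAt (Y := Y)) (A i)) :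
    IsAnalyticSubset (HolAt (Y := Y)) (⋃ i ∈ s, A i) := by
  classical
  induction s using Finset.induction_on with
  | empty => simpa using isAnalyticSubset_empty
  | insert i s _ ih =>
    rw [Finset.set_biUnion_insert]
    exact (hA i).union ih

end AnalyticSubsets

/-! ### Curves on the resolution -/

section Resolution

variable {Y : Type*} [TopologicalSpace Y] [ChartedSpace (EuclideanSpace ℂ (Fin 2)) Y]
  {X : Type*} [TopologicalSpace X] {𝒳 : ReducedComplexSpace X} {π : Y → X} {p : X}
  {ι : Type*} {C : ι → IrredCurve Y}

/-- The irreducible curves contracted by `π` are the components of the exceptional divisor. -/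
theorem subsingleton_image_iff (hπ : IsNormalResolution 𝒳 π p) (hC : IsADEResolution π p C)
    (Z : IrredCurve Y) : (π '' Z.1).Subsingleton ↔ Z ∈ Set.range C := by
  rw [hC.component]
  constructor
  · intro h
    obtain ⟨a, ha, b, hb, hab⟩ := Z.2.nontrivial
    have h1 : π a = p := by
      by_contra hne
      exact hab (hπ.inj_away a b (h ⟨a, ha, rfl⟩ ⟨b, hb, rfl⟩) hne)
    intro z hz
    exact (h ⟨z, hz, rfl⟩ ⟨a, ha, rfl⟩).trans h1
  · intro h
    exact (Set.subsingleton_singleton (a := p)).anti (Set.image_subset_iff.2 h)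

/-- Off `p` the map is injective, so Z is covered by Z' and the exceptional curves. By
irreducibility one of the two contains it, and the second would make Z contracted. -/
theorem subset_of_image_subset [Fintype ι] (hπ : IsNormalResolution 𝒳 π p)
    (hC : IsADEResolution π p C) {Z Z' : IrredCurve Y} (hZ : ¬ (π '' Z.1).Subsingleton)
    (h : π '' Z.1 ⊆ π '' Z'.1) : Z.1 ⊆ Z'.1 := by
  have hcover : Z.1 = (Z.1 ∩ Z'.1) ∪ (Z.1 ∩ ⋃ i ∈ (Finset.univ : Finset ι), (C i).1) := by
    rw [← Set.inter_union_distrib_left, eq_comm, Set.inter_eq_left]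
    intro z hz
    by_cases hp : π z = p
    · right
      have : z ∈ π ⁻¹' {p} := hp
      rw [hC.fiber] at this
      simpa using this
    · left
      obtain ⟨z', hz', hzz'⟩ := h ⟨z, hz, rfl⟩
      rwa [hπ.inj_away z z' hzz'.symm hp]
  rcases Z.2.irreducible _ _ (Z.2.analytic.inter Z'.2.analytic)
    (Z.2.analytic.inter (IsAnalyticSubset.biUnion _ _ fun i => (C i).2.analytic)) hcover
    with h1 | h1
  · exact Set.inter_eq_left.1 h1.symm
  · refine absurd ?_ hZ
    rw [subsingleton_image_iff hπ hC, hC.component, hC.fiber]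
    have := Set.inter_eq_left.1 h1.symm
    simpa using this

theorem injOn_image [Fintype ι] (hπ : IsNormalResolution 𝒳 π p) (hC : IsADEResolution π p C) :
    Set.InjOn (fun Z : IrredCurve Y => π '' Z.1) {Z | ¬ (π '' Z.1).Subsingleton} := by
  intro Z hZ Z' hZ' h
  exact Subtype.ext ((subset_of_image_subset hπ hC hZ h.subset).antisymm
    (subset_of_image_subset hπ hC hZ' h.superset))

theorem strictTransform_apply (hπ : IsNormalResolution 𝒳 π p) (hC : IsADEResolution π p C)
    {C₀ : Set X →₀ ℤ} {C₀t : Divisor Y}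
    (hC₀t : IsStrictTransform π C₀ C₀t) (i : ι) : C₀t (C i) = 0 := by
  by_contra h
  exact hC₀t.not_contracted _ (Finsupp.mem_support_iff.2 h)
    ((subsingleton_image_iff hπ hC _).2 ⟨i, rfl⟩)

end Resolution

/-! ### The intersection form -/

section Intersection

variable {Y : Type*} [TopologicalSpace Y] [ChartedSpace (EuclideanSpace ℂ (Fin 2)) Y]

theorem intersection_add_left (D D' E : Divisor Y) :
    intersection (D + D') E = intersection D E + intersection D' E := by
  unfold intersection
  refine Finsupp.sum_add_index' (fun Z => by simp) fun Z m m' => ?_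
  simp only [Finsupp.sum, ← Finset.sum_add_distrib, add_mul]

theorem curveIntersection_comm (Z Z' : IrredCurve Y) :
    curveIntersection Z Z' = curveIntersection Z' Z := by
  have hloc : ∀ y, localIntersection Z.1 Z'.1 y = localIntersection Z'.1 Z.1 y := fun y => by
    rw [localIntersection, localIntersection, sup_comm]
  unfold curveIntersection
  by_cases h : Z = Z'
  · subst h; rfl
  · rw [if_neg h, if_neg (Ne.symm h)]
    simp only [hloc]

theorem intersection_comm (D E : Divisor Y) : intersection D E = intersection E D := by
  unfold intersection
  rw [Finsupp.sum_comm]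
  simp only [mul_comm, curveIntersection_comm]

theorem intersection_add_right (D E E' : Divisor Y) :
    intersection D (E + E') = intersection D E + intersection D E' := by
  simp only [intersection_comm D, intersection_add_left]

theorem pairing_comm (D E : Divisor Y) : pairing D E = pairing E D := by
  rw [pairing, pairing, intersection_comm]

variable (Y) in
/-- The inner product on divisors as a bilinear form. -/
def pairingForm : LinearMap.BilinForm ℤ (Divisor Y) :=
  LinearMap.mk₂ ℤ pairing
    (fun D D' E => by simp only [pairing, intersection_add_left]; ring)
    (fun c D E => (AddMonoidHom.mk' (fun D => pairing D E) fun D D' => by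
      simp only [pairing, intersection_add_left]; ring).map_zsmul c D)
    (fun D E E' => by simp only [pairing, intersection_add_right]; ring)
    (fun c D E => (AddMonoidHom.mk' (fun E => pairing D E) fun E E' => by
      simp only [pairing, intersection_add_right]; ring).map_zsmul c E)

theorem pairingForm_apply (D E : Divisor Y) : pairingForm Y D E = pairing D E := rfl

theorem intersection_eq_neg (D E : Divisor Y) : intersection D E = -pairingForm Y D E := by
  rw [pairingForm_apply, pairing, neg_neg]

variable (Y) in
/-- The intersection number with the canonical class as a linear form. -/
def canonicalForm : Divisor Y →ₗ[ℤ] ℤ :=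
  (AddMonoidHom.mk' (canonicalDegree (Y := Y)) fun D D' =>
    Finsupp.sum_add_index' (fun Z => by simp) fun Z m m' => by ring).toIntLinearMap

theorem canonicalForm_apply (D : Divisor Y) : canonicalForm Y D = canonicalDegree D := rfl

theorem genus_eq_zero_iff (D : Divisor Y) :
    genus D = 0 ↔ intersection D D + canonicalDegree D = -2 := by
  unfold genus
  constructor
  · intro h
    have : ((intersection D D + canonicalDegree D : ℤ) : ℚ) = -2 := by linarith
    exact_mod_cast this
  · intro h
    rw [h]; norm_num

variable {ι : Type*} [Fintype ι]

/-- The divisor `∑ b i C i`. -/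
def latticeDivisor (C : ι → IrredCurve Y) : (ι → ℤ) →ₗ[ℤ] Divisor Y :=
  Fintype.linearCombination ℤ fun i => curveDivisor (C i)

/-- The inner product on the lattice spanned by the curves `C i`. -/
def latticeForm (C : ι → IrredCurve Y) : LinearMap.BilinForm ℤ (ι → ℤ) :=
  (pairingForm Y).compl₁₂ (latticeDivisor C) (latticeDivisor C)

variable {C : ι → IrredCurve Y}

theorem latticeForm_apply (b c : ι → ℤ) :
    latticeForm C b c = pairingForm Y (latticeDivisor C b) (latticeDivisor C c) := rfl

theorem latticeDivisor_apply (b : ι → ℤ) :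
    latticeDivisor C b = ∑ i, b i • curveDivisor (C i) := rfl

theorem latticeDivisor_unitVec [DecidableEq ι] (i : ι) :
    latticeDivisor C (unitVec i) = curveDivisor (C i) := by
  simp [latticeDivisor]

theorem latticeDivisor_apply_curve (hC : Function.Injective C) (b : ι → ℤ) (i : ι) :
    latticeDivisor C b (C i) = b i := by
  classical
  simp [latticeDivisor_apply, Finsupp.finsetSum_apply, curveDivisor, Finsupp.single_apply,
    hC.eq_iff]

theorem latticeDivisor_apply_of_notMem (b : ι → ℤ) {Z : IrredCurve Y} (hZ : Z ∉ Set.range C) :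
    latticeDivisor C b Z = 0 := by
  classical
  rw [latticeDivisor_apply, Finsupp.finsetSum_apply]
  refine Finset.sum_eq_zero fun i _ => ?_
  have : C i ≠ Z := fun h => hZ ⟨i, h⟩
  simp [curveDivisor, this]

theorem latticeDivisor_injective (hC : Function.Injective C) :
    Function.Injective (latticeDivisor C) := by
  intro b c h
  ext i
  rw [← latticeDivisor_apply_curve hC b, h, latticeDivisor_apply_curve hC]

theorem latticeDivisor_mem_closure (b : ι → ℤ) : latticeDivisor C b ∈
    AddSubgroup.closure (Set.range fun i => curveDivisor (C i)) := by
  rw [latticeDivisor_apply]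
  exact AddSubgroup.sum_mem _ fun i _ =>
    AddSubgroup.zsmul_mem _ (AddSubgroup.subset_closure (Set.mem_range_self i)) _

theorem mem_rootSet_iff {α : Divisor Y} :
    α ∈ rootSet C ↔ ∃ b, latticeForm C b b = 2 ∧ latticeDivisor C b = α := by
  constructor
  · rintro ⟨h1, h2⟩
    rw [← Submodule.span_int_eq_addSubgroupClosure, Submodule.mem_toAddSubgroup,
      Submodule.mem_span_range_iff_exists_fun] at h1
    obtain ⟨b, rfl⟩ := h1
    rw [intersection_eq_neg] at h2
    refine ⟨b, ?_, rfl⟩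
    rw [latticeForm_apply, latticeDivisor_apply]
    omega
  · rintro ⟨b, hb, rfl⟩
    refine ⟨latticeDivisor_mem_closure b, ?_⟩
    rw [intersection_eq_neg, ← latticeForm_apply, hb]

theorem latticeForm_isSimplyLaced [DecidableEq ι]
    (h : IsADECartanMatrix
      (Matrix.of fun i j => pairing (curveDivisor (C i)) (curveDivisor (C j)))) :
    IsSimplyLacedForm (latticeForm C) := by
  obtain ⟨-, hd, ho, hp⟩ := h.posDef
  refine ⟨fun a b => pairing_comm _ _, fun i => ?_, fun i j hij => ?_, fun b hb => ?_⟩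
  · rw [latticeForm_apply, latticeDivisor_unitVec]; exact hd i
  · rw [latticeForm_apply, latticeDivisor_unitVec, latticeDivisor_unitVec]; exact ho i j hij
  · refine (hp b hb).trans_eq ?_
    rw [IsSimplyLacedForm.apply_eq_sum]
    refine Finset.sum_congr rfl fun i _ => ?_
    rw [IsSimplyLacedForm.apply_eq_sum_right, Finset.mul_sum]
    refine Finset.sum_congr rfl fun j _ => ?_
    rw [latticeForm_apply, latticeDivisor_unitVec, latticeDivisor_unitVec]
    simp only [Matrix.of_apply, pairingForm_apply]
    ring

end Intersection

/-! ### Divisors with a prescribed image cycle -/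

section Image

variable {Y : Type*} [TopologicalSpace Y] [ChartedSpace (EuclideanSpace ℂ (Fin 2)) Y]
  {X : Type*} [TopologicalSpace X] {𝒳 : ReducedComplexSpace X} {π : Y → X} {p : X}
  {ι : Type*} [Fintype ι] {C : ι → IrredCurve Y} {C₀ : Set X →₀ ℤ} {C₀t : Divisor Y}

/-- Distinct non-contracted curves have distinct images, so the image cycle fixes their coefficients
and leaves those of the `C i` free. -/
theorem image_eq_iff (hπ : IsNormalResolution 𝒳 π p) (hC : IsADEResolution π p C)
    (hC₀t : IsStrictTransform π C₀ C₀t) (l : Divisor Y) :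
    image π l = C₀ ↔ ∃ β, l = C₀t + latticeDivisor C β := by
  classical
  have hfilter : ∀ Z (D : Divisor Y), (D.filter fun Z => ¬ (π '' Z.1).Subsingleton) Z =
      if Z ∈ Set.range C then 0 else D Z := by
    intro Z D
    rw [Finsupp.filter_apply, subsingleton_image_iff hπ hC]
    split_ifs <;> simp_all
  constructor
  · intro h
    have h1 : (l.filter fun Z => ¬ (π '' Z.1).Subsingleton) =
        C₀t.filter fun Z => ¬ (π '' Z.1).Subsingleton := by
      refine Finsupp.mapDomain_injOn _ (injOn_image hπ hC) ?_ ?_ (h.trans hC₀t.image_eq.symm)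
      · exact fun Z hZ => (Finset.mem_filter.1 hZ).2
      · exact fun Z hZ => (Finset.mem_filter.1 hZ).2
    refine ⟨fun i => l (C i), ?_⟩
    ext Z
    rw [Finsupp.add_apply]
    by_cases hZ : Z ∈ Set.range C
    · obtain ⟨i, rfl⟩ := hZ
      rw [latticeDivisor_apply_curve hC.injective, strictTransform_apply hπ hC hC₀t, zero_add]
    · rw [latticeDivisor_apply_of_notMem _ hZ, add_zero]
      have := DFunLike.congr_fun h1 Z
      rwa [hfilter, hfilter, if_neg hZ, if_neg hZ] at this
  · rintro ⟨β, rfl⟩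
    rw [← hC₀t.image_eq, image, image]
    congr 1
    ext Z
    rw [hfilter, hfilter]
    split_ifs with hZ
    · rfl
    · rw [Finsupp.add_apply, latticeDivisor_apply_of_notMem _ hZ, add_zero]

end Image

/-! ### The `(-1)`-curves over `C₀` -/

section NegOneCurves

variable {Y : Type*} [TopologicalSpace Y] [ChartedSpace (EuclideanSpace ℂ (Fin 2)) Y]
  {X : Type*} {π : Y → X} {p : X} {ι : Type*} [Fintype ι] [DecidableEq ι] {C : ι → IrredCurve Y}
  {C₀ : Set X →₀ ℤ} {C₀t : Divisor Y} {k : ι}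

/-- In pairings with Λ the strict transform plays the role of -ω_k. -/
theorem pairing_strictTransform (hC : IsADEResolution π p C)
    (hk : multiplicity C C₀t = curveDivisor (C k)) (b : ι → ℤ) :
    pairingForm Y C₀t (latticeDivisor C b) = -b k := by
  have h : (fun i => intersection C₀t (curveDivisor (C i))) = unitVec k :=
    latticeDivisor_injective hC.injective (hk.trans (latticeDivisor_unitVec k).symm)
  have h' : ∀ i, pairingForm Y C₀t (curveDivisor (C i)) = -(unitVec k : ι → ℤ) i := fun i => by
    rw [← congrFun h i, intersection_eq_neg, neg_neg]
  rw [latticeDivisor_apply]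
  simp [map_sum, map_smul, h', Pi.single_apply]

theorem pairing_curve_add (hC : IsADEResolution π p C)
    (hk : multiplicity C C₀t = curveDivisor (C k)) (β : ι → ℤ) (i : ι) :
    pairing (curveDivisor (C i)) (C₀t + latticeDivisor C β) =
      level (latticeForm C) k β (unitVec i) := by
  rw [pairing_comm, ← latticeDivisor_unitVec, ← pairingForm_apply, map_add, LinearMap.add_apply,
    pairing_strictTransform hC hk, level, latticeForm_apply]
  ring

theorem intersection_add_self (hC : IsADEResolution π p C)
    (hk : multiplicity C C₀t = curveDivisor (C k)) (hneg : IsNegOneCurve C₀t) (β : ι → ℤ) :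
    intersection (C₀t + latticeDivisor C β) (C₀t + latticeDivisor C β) =
      -1 - excess (latticeForm C) k β := by
  have h1 := hneg.self_intersection
  have h2 := pairing_strictTransform hC hk β
  have h3 : pairingForm Y (latticeDivisor C β) C₀t = -β k := by
    rw [← h2]; exact pairing_comm _ _
  rw [intersection_eq_neg] at h1 ⊢
  simp only [map_add, LinearMap.add_apply, h2, h3, excess, latticeForm_apply]
  omega

/-- By the genus formula, genus 0 and self-intersection -2 force K·C_i = 0. -/
theorem canonicalDegree_add (hC : IsADEResolution π p C) (β : ι → ℤ) :
    canonicalDegree (C₀t + latticeDivisor C β) = canonicalDegree C₀t := by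
  have h : ∀ i, canonicalForm Y (curveDivisor (C i)) = 0 := by
    intro i
    have h1 := (genus_eq_zero_iff _).1 (hC.genus_eq i)
    have h2 := (latticeForm_isSimplyLaced hC.cartan).diag i
    rw [latticeForm_apply, latticeDivisor_unitVec] at h2
    rw [intersection_eq_neg, h2] at h1
    rw [canonicalForm_apply]
    omega
  rw [← canonicalForm_apply, map_add, latticeDivisor_apply]
  simp [map_sum, map_smul, h, canonicalForm_apply]

variable [TopologicalSpace X] {𝒳 : ReducedComplexSpace X}

/-- Only the self-intersection is a genuine condition: effectivity follows from β ≥ 0 and the genus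
from K·β = 0. -/
theorem mem_negOneCurvesOver_iff (hπ : IsNormalResolution 𝒳 π p) (hC : IsADEResolution π p C)
    (hC₀t : IsStrictTransform π C₀ C₀t) (hneg : IsNegOneCurve C₀t)
    (hk : multiplicity C C₀t = curveDivisor (C k))
    (hle : ∀ θ : ι → ℤ, latticeForm C θ θ = 2 → 0 ≤ θ → θ k ≤ 1) (β : ι → ℤ) :
    C₀t + latticeDivisor C β ∈ negOneCurvesOver π C₀ ↔ excess (latticeForm C) k β = 0 := by
  have hself := intersection_add_self hC hk hneg β
  constructor
  · rintro ⟨h, -⟩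
    have := h.self_intersection
    omega
  · intro h
    refine ⟨⟨?_, ?_, by rw [hself, h]; norm_num⟩, (image_eq_iff hπ hC hC₀t _).2 ⟨β, rfl⟩⟩
    · have h0 := (latticeForm_isSimplyLaced hC.cartan).nonneg_of_excess_eq_zero hle h
      refine add_nonneg hneg.effective fun Z => ?_
      by_cases hZ : Z ∈ Set.range C
      · obtain ⟨i, rfl⟩ := hZ
        rw [latticeDivisor_apply_curve hC.injective]
        exact h0 i
      · rw [latticeDivisor_apply_of_notMem _ hZ]; rfl
    · have h1 := (genus_eq_zero_iff _).1 hneg.genus_eq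
      rw [genus_eq_zero_iff, canonicalDegree_add hC, hself, h]
      rw [hneg.self_intersection] at h1
      omega

/-- The `(-1)`-curves over `C₀` are the divisors `C₀t + β` for the weights `β - ω_k` of the
minuscule representation. -/
def negOneCurvesEquiv (hπ : IsNormalResolution 𝒳 π p) (hC : IsADEResolution π p C)
    (hC₀t : IsStrictTransform π C₀ C₀t) (hneg : IsNegOneCurve C₀t)
    (hk : multiplicity C C₀t = curveDivisor (C k))
    (hle : ∀ θ : ι → ℤ, latticeForm C θ θ = 2 → 0 ≤ θ → θ k ≤ 1) :
    {β : ι → ℤ // excess (latticeForm C) k β = 0} ≃ negOneCurvesOver π C₀ :=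
  Equiv.ofBijective (fun β => ⟨C₀t + latticeDivisor C β.1,
    (mem_negOneCurvesOver_iff hπ hC hC₀t hneg hk hle β.1).2 β.2⟩) (by
    constructor
    · intro β γ h
      exact Subtype.ext (latticeDivisor_injective hC.injective
        (add_left_cancel (Subtype.ext_iff.1 h)))
    · rintro ⟨l, hl⟩
      obtain ⟨β, rfl⟩ := (image_eq_iff hπ hC hC₀t l).1 hl.2
      exact ⟨⟨β, (mem_negOneCurvesOver_iff hπ hC hC₀t hneg hk hle β).1 hl⟩, rfl⟩)

end NegOneCurves

end ADESurface

end

noncomputable section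

namespace ADESurface

/-! ### Transfer between surface and lattice, and the two minuscule actions -/

section Main

variable {Y : Type*} [TopologicalSpace Y] [ChartedSpace (EuclideanSpace ℂ (Fin 2)) Y]
  {ι : Type*} [Fintype ι] {C : ι → IrredCurve Y}
  {𝔤 : Type*} [LieRing 𝔤] [LieAlgebra ℂ 𝔤]

open scoped Classical in
/-- The root vector of the root with coordinates `b`. -/
def ChevalleyBasis.rootVector (B : ChevalleyBasis C 𝔤) (b : ι → ℤ) : 𝔤 :=
  if h : latticeForm C b b = 2 then B.x ⟨latticeDivisor C b, mem_rootSet_iff.2 ⟨b, h, rfl⟩⟩ else 0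

theorem ChevalleyBasis.rootVector_eq (B : ChevalleyBasis C 𝔤) {b : ι → ℤ}
    (h : latticeForm C b b = 2) :
    B.rootVector b = B.x ⟨latticeDivisor C b, mem_rootSet_iff.2 ⟨b, h, rfl⟩⟩ := dif_pos h

theorem latticeDivisor_mem_rootSet_iff (hC : Function.Injective C) (b : ι → ℤ) :
    latticeDivisor C b ∈ rootSet C ↔ latticeForm C b b = 2 := by
  rw [mem_rootSet_iff]
  constructor
  · rintro ⟨c, hc, h⟩
    rwa [← latticeDivisor_injective hC h]
  · exact fun h => ⟨b, h, rfl⟩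

variable [DecidableEq ι]

/-- A Chevalley basis in the coordinates of the lattice spanned by the curves `C i`. -/
def ChevalleyBasis.toLattice (B : ChevalleyBasis C 𝔤) (hC : Function.Injective C) :
    LatticeChevalleyBasis (latticeForm C) 𝔤 where
  h := B.h
  X := B.rootVector
  lie_h_h := B.lie_h_h
  lie_h_X i α hα := by
    have h : latticeForm C α (unitVec i) =
        pairing (latticeDivisor C α) (curveDivisor (C i)) := by
      rw [latticeForm_apply, latticeDivisor_unitVec, pairingForm_apply]
    rw [h, B.rootVector_eq hα, B.lie_h_x]
  lie_X_neg α hα := by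
    have hα' : latticeForm C (-α) (-α) = 2 := by simpa using hα
    rw [B.rootVector_eq hα, B.rootVector_eq hα', B.lie_x_neg _ _ (map_neg _ _)]
    simp only [latticeDivisor_apply_curve hC]
  lie_X_add α β hα hβ hαβ := by
    rw [B.rootVector_eq hα, B.rootVector_eq hβ, B.rootVector_eq hαβ]
    exact B.lie_x_add _ _ _ (map_add _ _ _)
  lie_X_zero α β hα hβ h0 hαβ := by
    rw [B.rootVector_eq hα, B.rootVector_eq hβ]
    refine B.lie_x_zero _ _ ?_ ?_
    · rw [← map_add]
      exact fun h => h0 (latticeDivisor_injective hC (h.trans (map_zero _).symm))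
    · rwa [← map_add, latticeDivisor_mem_rootSet_iff hC]
  span_eq_top := by
    rw [eq_top_iff, ← B.span_eq_top]
    refine Submodule.span_mono ?_
    rintro _ ⟨i | ⟨α, hα⟩, rfl⟩
    · exact Or.inl ⟨i, rfl⟩
    · obtain ⟨b, hb, rfl⟩ := mem_rootSet_iff.1 hα
      exact Or.inr ⟨b, hb, B.rootVector_eq hb⟩

theorem ChevalleyBasis.toLattice_X (B : ChevalleyBasis C 𝔤) (hC : Function.Injective C)
    {b : ι → ℤ} (α : rootSet C) (h : latticeDivisor C b = α.1) :
    (B.toLattice hC).X b = B.x α := by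
  obtain ⟨α, hα⟩ := α
  obtain rfl : latticeDivisor C b = α := h
  exact B.rootVector_eq ((latticeDivisor_mem_rootSet_iff hC b).1 hα)

/-- The Weyl group preserves the set of weights `β - ω_k` with the norm of `ω_k`. -/
theorem weylGroup_preserves (hC : Function.Injective C) (hf : IsSimplyLacedForm (latticeForm C))
    (k : ι) {w : (ι → ℂ) ≃ₗ[ℂ] (ι → ℂ)} (hw : w ∈ weylGroup C) (μ : ι → ℂ) :
    (∃ β, excess (latticeForm C) k β = 0 ∧
      ∀ i, w μ i = (level (latticeForm C) k β (unitVec i) : ℂ)) ↔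
    ∃ β, excess (latticeForm C) k β = 0 ∧
      ∀ i, μ i = (level (latticeForm C) k β (unitVec i) : ℂ) := by
  induction hw using Subgroup.closure_induction generalizing μ with
  | one => rfl
  | mul x y _ _ hx hy => exact (hx (y μ)).trans (hy μ)
  | inv x _ hx =>
    have := hx (x⁻¹ μ)
    rw [show x (x⁻¹ μ) = μ from x.apply_symm_apply μ] at this
    exact this.symm
  | mem w hw =>
    obtain ⟨α, hα, hw⟩ := hw
    obtain ⟨a, ha, rfl⟩ := mem_rootSet_iff.1 hα
    have hw' : ∀ (μ : ι → ℂ) i, w μ i =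
        μ i - (∑ j, (a j : ℂ) * μ j) * (latticeForm C a (unitVec i) : ℂ) := by
      intro μ i
      rw [hw]
      simp only [latticeDivisor_apply_curve hC, latticeForm_apply, latticeDivisor_unitVec,
        pairingForm_apply]
    have hstep : ∀ μ : ι → ℂ, (∃ β, excess (latticeForm C) k β = 0 ∧
        ∀ i, μ i = (level (latticeForm C) k β (unitVec i) : ℂ)) →
        ∃ β, excess (latticeForm C) k β = 0 ∧
          ∀ i, w μ i = (level (latticeForm C) k β (unitVec i) : ℂ) := by
      rintro μ ⟨β, hβ, hμ⟩
      refine ⟨β - level (latticeForm C) k β a • a, by rw [hf.excess_reflection ha, hβ],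
        fun i => ?_⟩
      have hsum : ∑ j, (a j : ℂ) * μ j = level (latticeForm C) k β a := by
        rw [IsSimplyLacedForm.level_eq_sum]
        push_cast
        exact Finset.sum_congr rfl fun j _ => by rw [hμ]
      rw [hw', hsum, hμ, level_sub_left, map_smul, LinearMap.smul_apply, smul_eq_mul]
      push_cast
      ring
    -- The generator is an involution, so one implication yields the converse.
    have hinv : w (w μ) = μ := by
      have hsum : ∑ j, (a j : ℂ) * w μ j = -∑ j, (a j : ℂ) * μ j := by
        have h2 : ∑ j, (a j : ℂ) * (latticeForm C a (unitVec j) : ℂ) = 2 := by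
          rw [IsSimplyLacedForm.apply_eq_sum_right] at ha
          exact_mod_cast ha
        simp only [hw' μ, mul_sub, Finset.sum_sub_distrib]
        have : ∀ c : ℂ, ∑ j, (a j : ℂ) * (c * (latticeForm C a (unitVec j) : ℂ)) = c * 2 := by
          intro c
          rw [← h2, Finset.mul_sum]
          exact Finset.sum_congr rfl fun j _ => by ring
        rw [this]
        ring
      ext i
      rw [hw' (w μ), hsum, hw' μ]
      ring
    exact ⟨fun h => by simpa only [hinv] using hstep (w μ) h, hstep μ⟩

section Minuscule

variable {V : Type*} [AddCommGroup V] [Module ℂ V] [LieRingModule 𝔤 V] [LieModule ℂ 𝔤 V]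
  {B : ChevalleyBasis C 𝔤} {k : ι}

/-- By transitivity every weight is a Weyl image of the lowest one, which is β = 0, and the Weyl
group preserves the sphere. -/
theorem IsMinuscule.isMinusculeAction (hC : Function.Injective C)
    (hf : IsSimplyLacedForm (latticeForm C)) (hlow : HasLowestWeightDualToNeg B V k)
    (hV : IsMinuscule B V) :
    IsMinusculeAction (B.toLattice hC) (LieModule.toEnd ℂ 𝔤 V : 𝔤 →ₗ[ℂ] V →ₗ[ℂ] V) k := by
  obtain ⟨v₀, hv₀, hvk, hvi, -⟩ := hlow
  have hwt : ∀ i, ⁅B.h i, v₀⁆ = (level (latticeForm C) k 0 (unitVec i) : ℂ) • v₀ := by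
    intro i
    rw [level_zero_left]
    rcases eq_or_ne i k with rfl | hi
    · simp [hvk]
    · simp [hvi i hi, hi.symm]
  refine ⟨fun x y v => lie_lie x y v, ⟨v₀, hv₀, hwt⟩, fun β v hv hβ => ?_⟩
  obtain ⟨w, hw, hwμ⟩ := hV.transitive _ _ ⟨v₀, hv₀, hwt⟩ ⟨v, hv, hβ⟩
  obtain ⟨γ, hγ, h⟩ := (weylGroup_preserves hC hf k hw _).2 ⟨0, excess_zero, fun i => rfl⟩
  rw [hwμ] at h
  suffices β = γ by rwa [this]
  refine hf.eq_of_forall_unitVec fun i => ?_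
  have := h i
  simp only [level, Int.cast_inj] at this
  omega

/-- The span is a nonzero subrepresentation of an irreducible one. -/
theorem IsWeightFamily.span_eq_top {B' : LatticeChevalleyBasis (latticeForm C) 𝔤}
    (hf : IsSimplyLacedForm (latticeForm C)) (hirr : LieModule.IsIrreducible ℂ 𝔤 V)
    (h : IsMinusculeAction B' (LieModule.toEnd ℂ 𝔤 V : 𝔤 →ₗ[ℂ] V →ₗ[ℂ] V) k)
    {w : (ι → ℤ) → V}
    (hw : IsWeightFamily B' (LieModule.toEnd ℂ 𝔤 V : 𝔤 →ₗ[ℂ] V →ₗ[ℂ] V) k w) :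
    Submodule.span ℂ (w '' {β | excess (latticeForm C) k β = 0}) = ⊤ := by
  let N : LieSubmodule ℂ 𝔤 V :=
    { Submodule.span ℂ (w '' {β | excess (latticeForm C) k β = 0}) with
      lie_mem := fun {g v} hv => hw.apply_mem_span hf h g hv }
  have h0 : w 0 ∈ N := Submodule.subset_span ⟨0, excess_zero, rfl⟩
  have hN : N = ⊤ := (eq_bot_or_eq_top N).resolve_left fun hbot => by
    rw [hbot, LieSubmodule.mem_bot] at h0
    exact hw.ne_zero 0 excess_zero h0
  exact congrArg LieSubmodule.toSubmodule hN

end Minuscule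

section CurveAction

variable {B : ChevalleyBasis C 𝔤} {k : ι} {I : Set (Divisor Y)} {ε : rootSet C → I → ℤˣ}
  {ρ : 𝔤 →ₗ[ℂ] (I →₀ ℂ) →ₗ[ℂ] (I →₀ ℂ)}

theorem IsCurveAction.h_apply (h : IsCurveAction B I ε ρ) (i : ι) (v : I →₀ ℂ) (l : I) :
    ρ (B.h i) v l = (pairing (curveDivisor (C i)) l.1 : ℂ) * v l := by
  have hsingle : ∀ l : I, ρ (B.h i) (Finsupp.single l 1) =
      (pairing (curveDivisor (C i)) l.1 : ℂ) • Finsupp.single l 1 := by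
    intro l
    have := h.cartan (Pi.single i 1) l
    simpa [Pi.single_apply] using this
  induction v using Finsupp.induction_linear with
  | zero => simp
  | add v w hv hw => simp [hv, hw, mul_add]
  | single m c =>
    have : (Finsupp.single m c : I →₀ ℂ) = c • Finsupp.single m 1 := by simp
    rw [this, map_smul, hsingle]
    by_cases hm : m = l
    · subst hm; simp [mul_comm]
    · simp [hm]

/-- The `h i` act diagonally, so a weight vector with nonzero coordinate at l has the weight of l.
Irreducibility of the curve representation is not needed. -/
theorem IsCurveAction.isMinusculeAction (hC : Function.Injective C)
    (hf : IsSimplyLacedForm (latticeForm C)) (h : IsCurveAction B I ε ρ)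
    (e : {β : ι → ℤ // excess (latticeForm C) k β = 0} ≃ I)
    (he : ∀ β i, pairing (curveDivisor (C i)) (e β).1 = level (latticeForm C) k β.1 (unitVec i)) :
    IsMinusculeAction (B.toLattice hC) ρ k := by
  refine ⟨h.lie, ⟨Finsupp.single (e ⟨0, excess_zero⟩) 1, by simp, fun i => ?_⟩,
    fun β v hv hβ => ?_⟩
  · ext l
    rw [show (B.toLattice hC).h i = B.h i from rfl, h.h_apply, Finsupp.smul_apply, smul_eq_mul]
    by_cases hl : e ⟨0, excess_zero⟩ = l
    · rw [← hl, he]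
    · simp [hl]
  · obtain ⟨l, hl⟩ := Finsupp.ne_iff.1 hv
    obtain ⟨γ, rfl⟩ := e.surjective l
    suffices β = γ.1 by rw [this, γ.2]
    refine hf.eq_of_forall_unitVec fun i => ?_
    have h1 := DFunLike.congr_fun (hβ i) (e γ)
    rw [show (B.toLattice hC).h i = B.h i from rfl, h.h_apply, Finsupp.smul_apply, smul_eq_mul,
      he] at h1
    have h2 := mul_right_cancel₀ hl h1
    simp only [level, Int.cast_inj] at h2
    omega

end CurveAction

end Main

end ADESurface

end

theorem mainTheorem4
    {Y : Type*} [TopologicalSpace Y] [T2Space Y] [CompactSpace Y] [ConnectedSpace Y]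
    [ChartedSpace (EuclideanSpace ℂ (Fin 2)) Y]
    [IsManifold 𝓘(ℂ, EuclideanSpace ℂ (Fin 2)) ω Y]
    {X : Type*} [TopologicalSpace X] [T2Space X] [CompactSpace X]
    (𝒳 : ADESurface.ReducedComplexSpace X) (π : Y → X) (p : X)
    (hπ : ADESurface.IsNormalResolution 𝒳 π p)
    {ι : Type*} [Fintype ι] (C : ι → ADESurface.IrredCurve Y)
    (hC : ADESurface.IsADEResolution π p C)
    (C₀ : Set X →₀ ℤ) (hC₀ : ADESurface.IsCurveIn 𝒳 C₀) (hp : ∃ Z ∈ C₀.support, p ∈ Z)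
    (C₀t : ADESurface.Divisor Y) (hC₀t : ADESurface.IsStrictTransform π C₀ C₀t)
    (hneg : ADESurface.IsNegOneCurve C₀t)
    (k : ι) (hk : ADESurface.multiplicity C C₀t = ADESurface.curveDivisor (C k))
    {𝔤 : Type*} [LieRing 𝔤] [LieAlgebra ℂ 𝔤] (B : ADESurface.ChevalleyBasis C 𝔤)
    {V : Type*} [AddCommGroup V] [Module ℂ V] [LieRingModule 𝔤 V] [LieModule ℂ 𝔤 V]
    (hlow : ADESurface.HasLowestWeightDualToNeg B V k)
    (hV : ADESurface.IsMinuscule B V) :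
    (∃ (ε : ADESurface.rootSet C → ADESurface.negOneCurvesOver π C₀ → ℤˣ)
        (ρ : 𝔤 →ₗ[ℂ] (ADESurface.negOneCurvesOver π C₀ →₀ ℂ) →ₗ[ℂ]
          (ADESurface.negOneCurvesOver π C₀ →₀ ℂ)),
        ADESurface.IsCurveAction B (ADESurface.negOneCurvesOver π C₀) ε ρ) ∧
    (∀ (ε : ADESurface.rootSet C → ADESurface.negOneCurvesOver π C₀ → ℤˣ)
        (ρ : 𝔤 →ₗ[ℂ] (ADESurface.negOneCurvesOver π C₀ →₀ ℂ) →ₗ[ℂ]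
          (ADESurface.negOneCurvesOver π C₀ →₀ ℂ)),
        ADESurface.IsCurveAction B (ADESurface.negOneCurvesOver π C₀) ε ρ →
          ∃ Ψ : (ADESurface.negOneCurvesOver π C₀ →₀ ℂ) ≃ₗ[ℂ] V,
            ∀ (g : 𝔤) (v : ADESurface.negOneCurvesOver π C₀ →₀ ℂ), Ψ (ρ g v) = ⁅g, Ψ v⁆) ∧
    (ADESurface.negOneCurvesOver π C₀).Finite ∧
    (ADESurface.negOneCurvesOver π C₀).ncard = Module.finrank ℂ V := by
  classical
  have hf := ADESurface.latticeForm_isSimplyLaced hC.cartan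
  have hVact := hV.isMinusculeAction hC.injective hf hlow
  obtain ⟨w, hw⟩ := hVact.exists_weightFamily hf
  have hspan := hw.span_eq_top hf hV.irreducible hVact
  have := hV.finiteDimensional
  let e := ADESurface.negOneCurvesEquiv hπ hC hC₀t hneg hk (hVact.root_apply_le_one hf)
  let b : Module.Basis {β : ι → ℤ // ADESurface.excess (ADESurface.latticeForm C) k β = 0} ℂ V :=
    Module.Basis.mk (hw.linearIndependent hf hVact) (by
      rw [← hspan, Set.image_eq_range]; exact le_rfl)
  have hb : ∀ β, b β = w β.1 := fun β => Module.Basis.mk_apply _ _ β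
  let b' := b.reindex e
  have hcard : Module.finrank ℂ V = Nat.card (ADESurface.negOneCurvesOver π C₀) :=
    Module.finrank_eq_nat_card_basis b'
  have hfin : Finite (ADESurface.negOneCurvesOver π C₀) := Module.Finite.finite_basis b'
  have hmem := ADESurface.mem_negOneCurvesOver_iff hπ hC hC₀t hneg hk (hVact.root_apply_le_one hf)
  have hb' : ∀ β, b' (e β) = w β.1 := fun β => by simp [b', hb]
  have hadd : ∀ β a, (e β).1 + ADESurface.latticeDivisor C a =
      C₀t + ADESurface.latticeDivisor C (β.1 + a) := fun β a => by
    rw [map_add, ← add_assoc]; rfl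
  refine ⟨?_, fun ε ρ hρ => ?_, Set.toFinite _, hcard.symm⟩
  · have hroot : ∀ (α : ADESurface.rootSet C) (l : ADESurface.negOneCurvesOver π C₀),
        ∃ ε : ℤˣ, ∀ hl : l.1 + α.1 ∈ ADESurface.negOneCurvesOver π C₀,
          ⁅B.x α, b' l⁆ = ((ε : ℤ) : ℂ) • b' ⟨l.1 + α.1, hl⟩ := by
      intro α l
      obtain ⟨a, ha, hα⟩ := ADESurface.mem_rootSet_iff.1 α.2
      obtain ⟨β, rfl⟩ := e.surjective l
      by_cases hβ : ADESurface.excess (ADESurface.latticeForm C) k (β.1 + a) = 0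
      · obtain ⟨ε, hε⟩ := hw.root_sign hf hVact ha β.2 hβ
        refine ⟨ε, fun hl => ?_⟩
        have hl' : (⟨(e β).1 + α.1, hl⟩ : ADESurface.negOneCurvesOver π C₀) =
            e ⟨β.1 + a, hβ⟩ :=
          Subtype.ext ((congrArg _ hα.symm).trans (hadd β a))
        rw [hl', hb', hb', ← hε, B.toLattice_X hC.injective α hα]
        rfl
      -- The divisor `l + α` is not in I here, so the sign is arbitrary.
      · refine ⟨1, fun hl => absurd ((hmem _).1 ?_) hβ⟩
        rwa [← hadd, hα]
    choose ε hε using hroot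
    -- The action on V transported to ℂ^I along the basis of weight vectors.
    let ρ : 𝔤 →ₗ[ℂ] (ADESurface.negOneCurvesOver π C₀ →₀ ℂ) →ₗ[ℂ]
        (ADESurface.negOneCurvesOver π C₀ →₀ ℂ) :=
      b'.repr.conj.toLinearMap ∘ₗ (LieModule.toEnd ℂ 𝔤 V : 𝔤 →ₗ[ℂ] V →ₗ[ℂ] V)
    have hρ : ∀ g v, ρ g v = b'.repr ⁅g, b'.repr.symm v⁆ := fun g v => rfl
    refine ⟨ε, ρ, fun x y v => ?_, fun c l => ?_, fun α l hl => ?_, fun α l hl => ?_⟩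
    · simp [hρ]
    · obtain ⟨β, rfl⟩ := e.surjective l
      have hwt : ∀ i, ⁅B.h i, w β.1⁆ =
          (ADESurface.pairing (ADESurface.curveDivisor (C i)) (e β).1 : ℂ) • w β.1 := fun i => by
        rw [show (e β).1 = C₀t + ADESurface.latticeDivisor C β.1 from rfl,
          ADESurface.pairing_curve_add hC hk]
        exact hw.weight β.1 β.2 i
      rw [hρ, b'.repr_symm_single_one, hb', sum_lie]
      simp only [smul_lie, hwt, smul_smul, ← Finset.sum_smul]
      rw [map_smul, ← hb', b'.repr_self]
    · rw [hρ, b'.repr_symm_single_one, hε α l hl, map_smul, b'.repr_self]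
    · obtain ⟨a, ha, hα⟩ := ADESurface.mem_rootSet_iff.1 α.2
      obtain ⟨β, rfl⟩ := e.surjective l
      have h0 := hw.root_eq_zero hf hVact ha β.2 fun h => hl (by
        rw [← hα, hadd]; exact (hmem _).2 h)
      rw [B.toLattice_X hC.injective α hα] at h0
      rw [hρ, b'.repr_symm_single_one, hb']
      exact (congrArg b'.repr h0).trans (map_zero _)
  · have hρact := hρ.isMinusculeAction hC.injective hf e fun β i =>
      ADESurface.pairing_curve_add hC hk β.1 i
    obtain ⟨w', hw'⟩ := hρact.exists_weightFamily hf
    have hli := hw'.linearIndependent hf hρact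
    have : Finite {β : ι → ℤ // ADESurface.excess (ADESurface.latticeForm C) k β = 0} :=
      Finite.of_equiv _ e.symm
    have := Fintype.ofFinite {β : ι → ℤ // ADESurface.excess (ADESurface.latticeForm C) k β = 0}
    have := Fintype.ofFinite (ADESurface.negOneCurvesOver π C₀)
    -- The weight family of the curve action has |I| independent vectors in ℂ^I, so it is a basis.
    let c := basisOfLinearIndependentOfCardEqFinrank' _ hli (by
      rw [Module.finrank_finsupp_self]; exact Fintype.card_congr e)
    have hc : ∀ β, c β = w' β.1 := fun β => by simp [c]
    refine ⟨c.equiv b (Equiv.refl _), hw'.equivariant hf hρact ?_ hVact hw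
      (c.equiv b (Equiv.refl _)).toLinearMap fun β hβ => ?_⟩
    · rw [Set.image_eq_range, ← c.span_eq]
      congr 1
      ext v
      simp [hc]
    · rw [← hc ⟨β, hβ⟩, ← hb ⟨β, hβ⟩]
      simp
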